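/- Let $\ell$ be a prime number, $\overline{\mathbb Q}$ an algebraic closure of $\mathbb Q$, and fix an embedding $\overline{\mathbb Q}\subset\overline{\mathbb Q}_\ell$ into an algebraic closure of $\mathbb Q_\ell$; put $G=\mathrm{Gal}(\overline{\mathbb Q}/\mathbb Q)$. Definitions. A field $K\subset\overline{\mathbb Q}$ is *totally $\ell$-adic* if $K^\sigma\subset\mathbb Q_\ell$ for all $\sigma\in G$; the compositum $\mathbb Q_{t\ell}$ of all totally $\ell$-adic number fields is the maximal totally $\ell$-adic extension of $\mathbb Q$. An extension $K/F$ of subfields of $\overline{\mathbb Q}$, with $F$ totally $\ell$-adic, is called *quadratic unramified above $\ell$* if $[K:F]=2$ and every place of $F$ above $\ell$ is inert in $K$, i.e. every prime ideal $\mathfrak l\ni\ell$ of the ring of integers $\mathcal O_F$ generates a prime ideal of $\mathcal O_K$ (so that all local extensions above $\ell$ are unramified of degree exactly $2$). A number field $K$ has *unramified quadratic $\ell$-adic conjugation* if it is quadratic unramified above $\ell$ over some totally $\ell$-adic subfield $F$. For $a\in\overline{\mathbb Q}^\times$ let $K_a$ be the splitting field of the minimal polynomial of $a$ over $\mathbb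 Q$ and $H_a=K_a\cap\mathbb Q_\ell$; $a$ is an *$\ell$-Weil number* if $N_{K_a/H_a}(a^\sigma)$ is a root of unity for every $\sigma\in G$. It is *$\ell$-quadratic* if moreover $\mathbb Q[a]$ has unramified quadratic $\ell$-adic conjugation. Proposition. (i) If $a$ is an $\ell$-quadratic $\ell$-Weil number, then the Galois closure of $\mathbb Q[a]$ over $\mathbb Q$ has unramified quadratic $\ell$-adic conjugation. (ii) The subfield of $\overline{\mathbb Q}$ generated over $\mathbb Q$ by all $\ell$-quadratic $\ell$-Weil numbers contains $\mathbb Q_{t\ell}$, is quadratic unramified above $\ell$ over $\mathbb Q_{t\ell}$, and is the only subfield of $\overline{\mathbb Q}$ with these properties. -/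

import Mathlib

open scoped IntermediateField NumberField

/-- `ℚ̄ ∩ ℚ_ℓ`, where `ℚ̄` is regarded as a subfield of `ℚ̄_ℓ` through the embedding `ι`. -/
noncomputable def ladicSubfield {ℓ : ℕ} [Fact ℓ.Prime]
    {Qbar : Type*} [Field Qbar] [Algebra ℚ Qbar]
    (ι : Qbar →+* AlgebraicClosure ℚ_[ℓ]) :
    IntermediateField ℚ Qbar :=
  ((algebraMap ℚ_[ℓ] (AlgebraicClosure ℚ_[ℓ])).fieldRange.comap ι).toIntermediateField (by
    intro q
    rw [Subfield.mem_comap, eq_ratCast, map_ratCast]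
    exact SubfieldClass.ratCast_mem _ q)

theorem mem_ladicSubfield {ℓ : ℕ} [Fact ℓ.Prime]
    {Qbar : Type*} [Field Qbar] [Algebra ℚ Qbar]
    (ι : Qbar →+* AlgebraicClosure ℚ_[ℓ]) (x : Qbar) :
    x ∈ ladicSubfield ι ↔ ∃ y : ℚ_[ℓ], algebraMap ℚ_[ℓ] (AlgebraicClosure ℚ_[ℓ]) y = ι x :=
  Iff.rfl

/-- `K` is totally `ℓ`-adic: every conjugate `K^σ`, `σ ∈ Gal(ℚ̄/ℚ)`, lies in `ℚ_ℓ`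
(the field `K` may be an infinite algebraic extension of `ℚ`). -/
def IsTotallyLadic {ℓ : ℕ} [Fact ℓ.Prime]
    {Qbar : Type*} [Field Qbar] [Algebra ℚ Qbar]
    (ι : Qbar →+* AlgebraicClosure ℚ_[ℓ])
    (K : IntermediateField ℚ Qbar) : Prop :=
  ∀ σ : Qbar ≃ₐ[ℚ] Qbar,
    K.map (σ : Qbar →ₐ[ℚ] Qbar) ≤ ladicSubfield ι

/-- `K/F` is a quadratic extension that is totally inert above `ℓ`: `[K : F] = 2`, and every
prime `𝔩` of the ring of integers of `F` above `ℓ` stays prime in that of `K`. -/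
def IsQuadraticInertAbove (ℓ : ℕ) (F K : Type*) [Field F] [Field K] [Algebra F K] : Prop :=
  Module.finrank F K = 2 ∧
    ∀ 𝔩 : Ideal (𝓞 F), 𝔩.IsPrime → (ℓ : 𝓞 F) ∈ 𝔩 →
      (𝔩.map (algebraMap (𝓞 F) (𝓞 K))).IsPrime

/-- The number field `K` has unramified quadratic `ℓ`-adic conjugation: it is a quadratic
extension, totally inert above `ℓ`, of some totally `ℓ`-adic subfield `F`. -/
def HasUnramifiedQuadraticConj {ℓ : ℕ} [Fact ℓ.Prime]
    {Qbar : Type*} [Field Qbar] [Algebra ℚ Qbar]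
    (ι : Qbar →+* AlgebraicClosure ℚ_[ℓ])
    (K : IntermediateField ℚ Qbar) : Prop :=
  FiniteDimensional ℚ K ∧
    ∃ (F : IntermediateField ℚ Qbar) (h : F ≤ K),
      IsTotallyLadic ι F ∧ IsQuadraticInertAbove ℓ F (IntermediateField.extendScalars h)

/-- The splitting field `K_a` in `ℚ̄` of the minimal polynomial of `a` over `ℚ`. -/
noncomputable def rootField
    {Qbar : Type*} [Field Qbar] [Algebra ℚ Qbar] (a : Qbar) :
    IntermediateField ℚ Qbar :=
  IntermediateField.adjoin ℚ ((minpoly ℚ a).rootSet Qbar)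

theorem conj_mem_rootField
    {Qbar : Type*} [Field Qbar] [Algebra ℚ Qbar] [IsAlgClosure ℚ Qbar] (a : Qbar)
    (σ : Qbar ≃ₐ[ℚ] Qbar) : σ a ∈ rootField a := by
  apply IntermediateField.subset_adjoin
  rw [Polynomial.mem_rootSet]
  refine ⟨minpoly.ne_zero ((IsAlgClosure.isAlgebraic (R := ℚ) (K := Qbar)).isAlgebraic a).isIntegral, ?_⟩
  rw [Polynomial.aeval_algHom_apply, minpoly.aeval, map_zero]

/-- The local norm `ν_a = N_{K_a/H_a}`, with `H_a = K_a ∩ ℚ_ℓ`, of the conjugate `a^σ`. -/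
noncomputable def localNorm {ℓ : ℕ} [Fact ℓ.Prime]
    {Qbar : Type*} [Field Qbar] [Algebra ℚ Qbar] [IsAlgClosure ℚ Qbar]
    (ι : Qbar →+* AlgebraicClosure ℚ_[ℓ]) (a : Qbar)
    (σ : Qbar ≃ₐ[ℚ] Qbar) :
    ↥(rootField a ⊓ ladicSubfield ι) :=
  Algebra.norm ↥(rootField a ⊓ ladicSubfield ι)
    (⟨σ a, conj_mem_rootField a σ⟩ : IntermediateField.extendScalars
      (inf_le_left : rootField a ⊓ ladicSubfield ι ≤ rootField a))

/-- `a` is an `ℓ`-Weil number: the local norm of each of its conjugates is a root of unity. -/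
def IsLadicWeilNumber {ℓ : ℕ} [Fact ℓ.Prime]
    {Qbar : Type*} [Field Qbar] [Algebra ℚ Qbar] [IsAlgClosure ℚ Qbar]
    (ι : Qbar →+* AlgebraicClosure ℚ_[ℓ]) (a : Qbar) : Prop :=
  a ≠ 0 ∧ ∀ σ : Qbar ≃ₐ[ℚ] Qbar,
    ∃ n : ℕ, 0 < n ∧ localNorm ι a σ ^ n = 1

/-- `a` is an `ℓ`-quadratic `ℓ`-Weil number. -/
def IsQuadraticWeilNumber {ℓ : ℕ} [Fact ℓ.Prime]
    {Qbar : Type*} [Field Qbar] [Algebra ℚ Qbar] [IsAlgClosure ℚ Qbar]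
    (ι : Qbar →+* AlgebraicClosure ℚ_[ℓ]) (a : Qbar) : Prop :=
  IsLadicWeilNumber ι a ∧ HasUnramifiedQuadraticConj ι ℚ⟮a⟯

/-- The maximal totally `ℓ`-adic extension of `ℚ`: the compositum in `ℚ̄` of all totally
`ℓ`-adic number fields. -/
noncomputable def maxTotallyLadic {ℓ : ℕ} [Fact ℓ.Prime]
    {Qbar : Type*} [Field Qbar] [Algebra ℚ Qbar]
    (ι : Qbar →+* AlgebraicClosure ℚ_[ℓ]) :
    IntermediateField ℚ Qbar :=
  sSup {K | FiniteDimensional ℚ K ∧ IsTotallyLadic ι K}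

/-- `maxTotallyLadic` is indeed the largest totally `ℓ`-adic subfield of `ℚ̄`. -/
theorem isGreatest_maxTotallyLadic {ℓ : ℕ} [Fact ℓ.Prime]
    {Qbar : Type*} [Field Qbar] [Algebra ℚ Qbar] [IsAlgClosure ℚ Qbar]
    (ι : Qbar →+* AlgebraicClosure ℚ_[ℓ]) :
    IsGreatest {K | IsTotallyLadic ι K} (maxTotallyLadic ι) := by
  constructor
  · intro σ
    rw [IntermediateField.map_le_iff_le_comap]
    refine sSup_le fun K hK => ?_
    rw [← IntermediateField.map_le_iff_le_comap]
    exact hK.2 σ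
  · intro K hK x hx
    have hxK : ℚ⟮x⟯ ≤ K := by simpa using hx
    have hle : ℚ⟮x⟯ ≤ maxTotallyLadic ι :=
      le_sSup ⟨IntermediateField.adjoin.finiteDimensional ((IsAlgClosure.isAlgebraic (R := ℚ) (K := Qbar)).isAlgebraic x).isIntegral,
        fun σ => (IntermediateField.map_mono _ hxK).trans (hK σ)⟩
    exact hle (IntermediateField.mem_adjoin_simple_self ℚ x)

/-- The subfield of `ℚ̄` generated over `ℚ` by all `ℓ`-quadratic `ℓ`-Weil numbers. -/
noncomputable def quadraticWeilField {ℓ : ℕ} [Fact ℓ.Prime]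
    {Qbar : Type*} [Field Qbar] [Algebra ℚ Qbar] [IsAlgClosure ℚ Qbar]
    (ι : Qbar →+* AlgebraicClosure ℚ_[ℓ]) :
    IntermediateField ℚ Qbar :=
  IntermediateField.adjoin ℚ {a | IsQuadraticWeilNumber ι a}

/-! Write `T` for the maximal totally ℓ-adic field. Everything rests on the fact that `ℚ_ℓ` has only
one unramified quadratic extension. Take integers `t`, `n` with `X ^ 2 - t X + n` irreducible modulo
ℓ, and let `δ` be a square root of its discriminant; then `δ` generates this extension, and the
field of the theorem is `M = T(δ)`.

If `K = F(y)`, `y ^ 2 = e`, is inert above ℓ over a totally ℓ-adic `F`, then under each embedding of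
`F` in `ℚ_ℓ` the element `e` has the square class of `δ ^ 2`. Hence every conjugate of `y δ` lies in
`ℚ_ℓ`, so `y δ ∈ T` and `K ⊆ M` (`IsInertSqrt.exists_mul_mem_maxTotallyLadic`). For `F = T` this
forces `K = M`, which is uniqueness. Conversely, such a `y` generates an inert extension
(`IsInertSqrt.isQuadraticInertAbove`).

For (i), `M` is Galois over `ℚ`, so it contains the normal closure `N` of `K`. The automorphism over
`T` with `δ ↦ -δ` splits elements of `N` into their `T` and `T δ` components, so `N` is quadratic
and inert over `N ∩ T`.

For (ii), the Cayley transform `(1 + b) / (1 - b)` of `b = δ / u`, with `u ∈ T` nonzero, is an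
ℓ-quadratic ℓ-Weil number: the same automorphism exchanges numerator and denominator, so all local
norms are 1. Inverting the transform recovers every `δ / u`, hence `δ`, `T` and `M`.

The fields may have infinite degree, so their integers need not form Dedekind domains; the inertness
arguments use traces, norms and explicit congruences instead. -/

theorem ZMod.two_sq_sub_add_ne_zero_iff (x y : ZMod 2) :
    (∀ c, c ^ 2 - x * c + y ≠ 0) ↔ x = 1 ∧ y = 1 := by
  revert x y
  decide

/-! ### Square classes and norm forms over `ℚ_ℓ` -/

section Local

variable {ℓ : ℕ} [Fact ℓ.Prime]

/-- The polynomial `X ^ 2 - t * X + n` over `ℤ_ℓ` has no root modulo `ℓ`. -/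
def ResiduallyIrreducible (t n : ℤ_[ℓ]) : Prop :=
  ∀ c : ℤ_[ℓ], ‖c ^ 2 - t * c + n‖ = 1

theorem PadicInt.norm_eq_one_iff_toZMod_ne_zero (x : ℤ_[ℓ]) :
    ‖x‖ = 1 ↔ PadicInt.toZMod x ≠ 0 := by
  rw [← PadicInt.isUnit_iff, ← not_iff_not, not_not, ← RingHom.mem_ker, PadicInt.ker_toZMod,
    IsLocalRing.mem_maximalIdeal, mem_nonunits_iff]

theorem residuallyIrreducible_iff (t n : ℤ_[ℓ]) :
    ResiduallyIrreducible t n ↔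
      ∀ c : ZMod ℓ, c ^ 2 - PadicInt.toZMod t * c + PadicInt.toZMod n ≠ 0 := by
  constructor
  · intro h c
    obtain ⟨k, rfl⟩ := ZMod.intCast_surjective c
    have := (PadicInt.norm_eq_one_iff_toZMod_ne_zero _).1 (h (k : ℤ_[ℓ]))
    simpa using this
  · intro h c
    rw [PadicInt.norm_eq_one_iff_toZMod_ne_zero]
    simpa using h (PadicInt.toZMod c)

variable (ℓ) in
theorem exists_residuallyIrreducible :
    ∃ t n : ℤ, ResiduallyIrreducible (t : ℤ_[ℓ]) (n : ℤ_[ℓ]) := by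
  by_cases hl : ℓ = 2
  · subst hl
    refine ⟨1, 1, (residuallyIrreducible_iff _ _).2 ?_⟩
    rw [ZMod.two_sq_sub_add_ne_zero_iff]
    simp
  · obtain ⟨a, ha⟩ := FiniteField.exists_nonsquare (F := ZMod ℓ) (by rwa [ZMod.ringChar_zmod_n])
    obtain ⟨k, rfl⟩ := ZMod.intCast_surjective a
    refine ⟨0, -k, (residuallyIrreducible_iff _ _).2 fun c hc => ha ⟨c, ?_⟩⟩
    simp only [Int.cast_zero, map_zero, map_intCast] at hc
    rw [Int.cast_neg] at hc
    linear_combination -hc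

theorem PadicInt.exists_sq_eq_of_norm_lt (u a : ℤ_[ℓ]) (h : ‖a ^ 2 - u‖ < ‖2 * a‖ ^ 2) :
    ∃ s : ℤ_[ℓ], s ^ 2 = u := by
  have := hensels_lemma (p := ℓ) (R := ℤ_[ℓ]) (F := Polynomial.X ^ 2 - Polynomial.C u) (a := a)
    (by simpa [one_add_one_eq_two] using h)
  obtain ⟨z, hz, -⟩ := this
  exact ⟨z, by simpa [sub_eq_zero] using hz⟩

theorem PadicInt.exists_coe_eq_of_isIntegral {x : ℚ_[ℓ]} (hx : IsIntegral ℤ_[ℓ] x) :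
    ∃ y : ℤ_[ℓ], (y : ℚ_[ℓ]) = x :=
  IsIntegrallyClosed.isIntegral_iff.1 hx

/-- A square discriminant would give a root in `ℚ_ℓ`; being integral, it would lie in `ℤ_ℓ` and
contradict irreducibility modulo ℓ. -/
theorem ResiduallyIrreducible.not_isSquare {t n : ℤ_[ℓ]} (h : ResiduallyIrreducible t n) :
    ¬ IsSquare ((t : ℚ_[ℓ]) ^ 2 - 4 * n) := by
  rintro ⟨s, hs⟩
  have hroot : (((t : ℚ_[ℓ]) + s) / 2) ^ 2 - t * ((t + s) / 2) + n = 0 := by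
    linear_combination -hs / 4
  have hint : IsIntegral ℤ_[ℓ] (((t : ℚ_[ℓ]) + s) / 2) := by
    refine ⟨Polynomial.X ^ 2 - Polynomial.C t * Polynomial.X + Polynomial.C n, ?_, ?_⟩
    · monicity!
    · simpa using hroot
  obtain ⟨c, hc⟩ := PadicInt.exists_coe_eq_of_isIntegral hint
  rw [← hc] at hroot
  have h0 : c ^ 2 - t * c + n = 0 := by
    apply Subtype.coe_injective
    push_cast
    exact hroot
  have := h c
  rw [h0] at this
  simp at this

/-- This is the uniqueness of the unramified quadratic extension of `ℚ_ℓ`. For odd ℓ, both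
discriminants are nonsquare units, so their product is a square modulo ℓ. For ℓ = 2, both are 5
modulo 8, so their product is 1 modulo 8. Hensel's lemma lifts the root. -/
theorem ResiduallyIrreducible.exists_sq_eq_mul {t n t' n' : ℤ_[ℓ]}
    (h : ResiduallyIrreducible t n) (h' : ResiduallyIrreducible t' n') :
    ∃ s : ℤ_[ℓ], s ^ 2 = (t ^ 2 - 4 * n) * (t' ^ 2 - 4 * n') := by
  by_cases hl : ℓ = 2
  · subst hl
    rw [residuallyIrreducible_iff] at h h'
    apply PadicInt.exists_sq_eq_of_norm_lt _ 1
    have odd {t n : ℤ_[2]}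
        (h : ∀ c : ZMod 2, c ^ 2 - PadicInt.toZMod t * c + PadicInt.toZMod n ≠ 0) :
        ∃ a b : ℤ_[2], t = 1 + 2 * a ∧ n = 1 + 2 * b := by
      obtain ⟨h1, h2⟩ := (ZMod.two_sq_sub_add_ne_zero_iff _ _).1 h
      have aux (z : ℤ_[2]) (hz : PadicInt.toZMod z = 1) : ∃ a, z = 1 + 2 * a := by
        have : z - 1 ∈ RingHom.ker (PadicInt.toZMod (p := 2)) := by simp [RingHom.mem_ker, hz]
        rw [PadicInt.ker_toZMod, PadicInt.maximalIdeal_eq_span_p, Ideal.mem_span_singleton] at this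
        obtain ⟨a, ha⟩ := this
        exact ⟨a, by push_cast at ha; linear_combination ha⟩
      obtain ⟨a, ha⟩ := aux t h1
      obtain ⟨b, hb⟩ := aux n h2
      exact ⟨a, b, ha, hb⟩
    obtain ⟨a, b, rfl, rfl⟩ := odd h
    obtain ⟨a', b', rfl, rfl⟩ := odd h'
    set u := ((1 + 2 * a) ^ 2 - 4 * (1 + 2 * b)) * ((1 + 2 * a') ^ 2 - 4 * (1 + 2 * b')) with hu
    have hmem : 1 ^ 2 - u ∈ Ideal.span {((2 : ℕ) : ℤ_[2]) ^ 3} := by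
      rw [← PadicInt.ker_toZModPow, RingHom.mem_ker, hu]
      simp only [map_sub, map_mul, map_pow, map_add, map_one, map_ofNat]
      generalize PadicInt.toZModPow 3 a = a
      generalize PadicInt.toZModPow 3 b = b
      generalize PadicInt.toZModPow 3 a' = a'
      generalize PadicInt.toZModPow 3 b' = b'
      have key : ∀ a b : ZMod (2 ^ 3), (1 + 2 * a) ^ 2 - 4 * (1 + 2 * b) = 5 := by decide
      rw [key, key]
      decide
    -- Hensel at the approximate root 1 needs `‖1 - u‖ < ‖2‖ ^ 2 = 1/4`; the congruence modulo 8
    -- gives at most `1/8`.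
    rw [← PadicInt.norm_le_pow_iff_mem_span_pow] at hmem
    refine hmem.trans_lt ?_
    have : ‖(2 : ℤ_[2])‖ = 2⁻¹ := by simpa using PadicInt.norm_p (p := 2)
    rw [mul_one, this]
    norm_num
  · have hchar : ringChar (ZMod ℓ) ≠ 2 := by rwa [ZMod.ringChar_zmod_n]
    have two_ne : (2 : ZMod ℓ) ≠ 0 := Ring.two_ne_zero hchar
    have nsq {t n : ℤ_[ℓ]} (h : ResiduallyIrreducible t n) :
        ¬ IsSquare (PadicInt.toZMod (t ^ 2 - 4 * n)) := by
      rintro ⟨s, hs⟩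
      simp only [map_sub, map_mul, map_pow, map_ofNat] at hs
      refine (residuallyIrreducible_iff t n).1 h ((PadicInt.toZMod t + s) / 2) ?_
      field_simp
      linear_combination -hs
    have hsq : IsSquare (PadicInt.toZMod ((t ^ 2 - 4 * n) * (t' ^ 2 - 4 * n'))) := by
      have h1 := quadraticChar_neg_one_iff_not_isSquare.2 (nsq h)
      have h2 := quadraticChar_neg_one_iff_not_isSquare.2 (nsq h')
      by_contra h3
      rw [← quadraticChar_neg_one_iff_not_isSquare, map_mul, map_mul, h1, h2] at h3
      norm_num at h3
    have hne : PadicInt.toZMod ((t ^ 2 - 4 * n) * (t' ^ 2 - 4 * n')) ≠ 0 := by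
      rw [map_mul]
      refine mul_ne_zero (fun h0 => nsq h ?_) (fun h0 => nsq h' ?_) <;> simp [h0]
    obtain ⟨r, hr⟩ := hsq
    obtain ⟨k, rfl⟩ := ZMod.intCast_surjective r
    apply PadicInt.exists_sq_eq_of_norm_lt _ (k : ℤ_[ℓ])
    have hk : ‖2 * (k : ℤ_[ℓ])‖ = 1 := by
      rw [PadicInt.norm_eq_one_iff_toZMod_ne_zero, map_mul, map_intCast, map_ofNat]
      refine mul_ne_zero two_ne fun h0 => hne ?_
      rw [hr, h0, zero_mul]
    rw [hk, one_pow]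
    refine lt_of_le_of_ne (PadicInt.norm_le_one _) ?_
    rw [Ne, PadicInt.norm_eq_one_iff_toZMod_ne_zero, not_not, map_sub, hr]
    simp [sq]

theorem Padic.norm_le_inv_of_norm_lt_one {x : ℚ_[ℓ]} (hx : ‖x‖ < 1) : ‖x‖ ≤ (ℓ : ℝ)⁻¹ := by
  have := (Padic.norm_le_pow_iff_norm_lt_pow_add_one x (-1)).2 (by simpa using hx)
  simpa using this

/-- The norm of the unramified quadratic extension has no nontrivial zero modulo ℓ. If `‖a‖ ≤ ‖b‖`,
factor out `b ^ 2` and evaluate the polynomial at `-a / b`; otherwise the term `a ^ 2` dominates. -/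
theorem ResiduallyIrreducible.norm_form_eq {t n : ℤ_[ℓ]} (h : ResiduallyIrreducible t n)
    (a b : ℚ_[ℓ]) :
    ‖a ^ 2 + t * a * b + n * b ^ 2‖ = max ‖a‖ ‖b‖ ^ 2 := by
  have hn : ‖n‖ = 1 := by simpa using h 0
  rcases le_or_gt ‖a‖ ‖b‖ with hab | hab
  · rw [max_eq_right hab]
    by_cases hb : b = 0
    · subst hb
      have : a = 0 := by simpa using hab
      simp [this]
    have hc : ‖-(a / b)‖ ≤ 1 := by
      rw [norm_neg, norm_div]
      exact div_le_one_of_le₀ hab (norm_nonneg _)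
    have h1 := h ⟨_, hc⟩
    replace h1 : ‖(-(a / b)) ^ 2 - (t : ℚ_[ℓ]) * (-(a / b)) + n‖ = 1 := h1
    have : a ^ 2 + t * a * b + n * b ^ 2 = b ^ 2 * ((-(a / b)) ^ 2 - t * (-(a / b)) + n) := by
      field_simp
      ring
    rw [this, norm_mul, h1, norm_pow, mul_one]
  · rw [max_eq_left hab.le]
    have ha : a ≠ 0 := by
      rintro rfl
      simp only [norm_zero] at hab
      exact absurd hab (not_lt.2 (norm_nonneg b))
    have hc : ‖b / a‖ < 1 := by
      rw [norm_div]
      exact (div_lt_one (norm_pos_iff.2 ha)).2 hab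
    have h1 : ‖(t : ℚ_[ℓ]) * (b / a) + n * (b / a) ^ 2‖ < 1 := by
      have : (t : ℚ_[ℓ]) * (b / a) + n * (b / a) ^ 2 = (b / a) * (t + n * (b / a)) := by ring
      rw [this, norm_mul]
      have h2 : ‖(t : ℚ_[ℓ]) + n * (b / a)‖ ≤ 1 := by
        refine (Padic.nonarchimedean _ _).trans (max_le t.2 ?_)
        rw [norm_mul]
        exact mul_le_one₀ n.2 (norm_nonneg _) hc.le
      exact mul_lt_one_of_nonneg_of_lt_one_left (norm_nonneg _) hc h2
    have : a ^ 2 + t * a * b + n * b ^ 2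
        = a ^ 2 * (1 + (t * (b / a) + n * (b / a) ^ 2)) := by
      field_simp
      ring
    rw [this, norm_mul, Padic.add_eq_max_of_ne (by rw [norm_one]; exact h1.ne'), norm_one,
      max_eq_left h1.le, norm_pow, mul_one]

end Local

/-! ### Quadratic extensions in characteristic zero -/

section Quadratic

variable {F K : Type*} [Field F] [Field K] [Algebra F K]

/-- `K = F + F * y` is a quadratic extension of `F`, generated by the square root `y` of `e`. -/
structure IsSqrtGenerator (y : K) (e : F) : Prop where
  sq_eq : y ^ 2 = algebraMap F K e
  notMem : ∀ f : F, algebraMap F K f ≠ y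
  exists_eq : ∀ z : K, ∃ f g : F, z = algebraMap F K f + algebraMap F K g * y

namespace IsSqrtGenerator

variable {y : K} {e : F}

theorem exists_basis (h : IsSqrtGenerator y e) : ∃ b : Module.Basis (Fin 2) F K, ⇑b = ![1, y] := by
  have hli : LinearIndependent F ![1, y] := by
    rw [LinearIndependent.pair_iff]
    intro s t hst
    simp only [Algebra.smul_def, mul_one] at hst
    have ht : t = 0 := by
      by_contra ht
      refine h.notMem (-s / t) ?_
      have : algebraMap F K t ≠ 0 := by simpa using ht
      rw [map_div₀, map_neg]
      field_simp
      linear_combination -hst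
    subst ht
    simpa using hst
  have hsp : ⊤ ≤ Submodule.span F (Set.range ![1, y]) := by
    intro z _
    obtain ⟨f, g, rfl⟩ := h.exists_eq z
    rw [Matrix.range_cons, Matrix.range_cons, Matrix.range_empty, Set.union_empty,
      Set.singleton_union, Submodule.mem_span_pair]
    exact ⟨f, g, by simp [Algebra.smul_def]⟩
  exact ⟨Module.Basis.mk hli hsp, Module.Basis.coe_mk hli hsp⟩

theorem finrank_eq (h : IsSqrtGenerator y e) : Module.finrank F K = 2 := by
  obtain ⟨b, -⟩ := h.exists_basis
  simpa using Module.finrank_eq_card_basis b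

theorem exists_linearMap (h : IsSqrtGenerator y e) :
    ∃ g : K →ₗ[F] F, (∀ c : F, g (algebraMap F K c) = 0) ∧
      ∀ z, ∃ f : F, z = algebraMap F K f + algebraMap F K (g z) * y := by
  obtain ⟨b, hb⟩ := h.exists_basis
  have hrep (z : K) : z = algebraMap F K (b.coord 0 z) + algebraMap F K (b.coord 1 z) * y := by
    conv_lhs => rw [← b.sum_repr z]
    simp [hb, Algebra.smul_def, Fin.sum_univ_two]
  have h0 : (1 : K) = b 0 := by simp [hb]
  refine ⟨b.coord 1, fun c => ?_, fun z => ⟨_, hrep z⟩⟩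
  rw [Algebra.algebraMap_eq_smul_one, map_smul, h0]
  simp

theorem ne_zero (h : IsSqrtGenerator y e) : y ≠ 0 := fun h0 => h.notMem 0 (by simp [h0])

theorem exists_conj [CharZero F] (h : IsSqrtGenerator y e) :
    ∃ τ : K ≃ₐ[F] K, τ y = -y := by
  have : Algebra.IsQuadraticExtension F K := ⟨h.finrank_eq⟩
  have : FiniteDimensional F K := Module.finite_of_finrank_pos (by rw [h.finrank_eq]; norm_num)
  have hy : y ∉ (⊥ : IntermediateField F K) := by
    rw [IntermediateField.mem_bot]
    rintro ⟨f, hf⟩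
    exact h.notMem f hf
  rw [IsGalois.mem_bot_iff_fixed] at hy
  push Not at hy
  obtain ⟨τ, hτ⟩ := hy
  refine ⟨τ, ?_⟩
  have : (τ y) ^ 2 = y ^ 2 := by rw [← map_pow, h.sq_eq, AlgEquiv.commutes]
  exact (sq_eq_sq_iff_eq_or_eq_neg.1 this).resolve_left hτ

end IsSqrtGenerator

theorem exists_isSqrtGenerator [CharZero F] (h : Module.finrank F K = 2) :
    ∃ (y : K) (e : F), IsSqrtGenerator y e := by
  have : FiniteDimensional F K := Module.finite_of_finrank_pos (by rw [h]; norm_num)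
  obtain ⟨x, hx⟩ : ∃ x : K, ∀ f : F, algebraMap F K f ≠ x := by
    by_contra! hall
    have : (⊥ : Subalgebra F K) = ⊤ := by
      rw [eq_top_iff]
      intro z _
      exact Algebra.mem_bot.2 (hall z)
    rw [Subalgebra.bot_eq_top_iff_finrank_eq_one, h] at this
    norm_num at this
  have hli : LinearIndependent F ![1, x] := by
    rw [LinearIndependent.pair_iff]
    intro s t hst
    simp only [Algebra.smul_def, mul_one] at hst
    have ht : t = 0 := by
      by_contra ht
      refine hx (-s / t) ?_
      have : algebraMap F K t ≠ 0 := by simpa using ht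
      rw [map_div₀, map_neg]
      field_simp
      linear_combination -hst
    subst ht
    simpa using hst
  have hspan : Submodule.span F (Set.range ![1, x]) = ⊤ :=
    hli.span_eq_top_of_card_eq_finrank' (by simp [h])
  have hrep (z : K) : ∃ p q : F, z = algebraMap F K p + algebraMap F K q * x := by
    have hz : z ∈ Submodule.span F (Set.range ![1, x]) := hspan ▸ Submodule.mem_top
    rw [Matrix.range_cons, Matrix.range_cons, Matrix.range_empty, Set.union_empty,
      Set.singleton_union, Submodule.mem_span_pair] at hz
    obtain ⟨p, q, rfl⟩ := hz
    exact ⟨p, q, by simp [Algebra.smul_def]⟩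
  obtain ⟨p, q, hpq⟩ := hrep (x ^ 2)
  have : CharZero K := charZero_of_injective_algebraMap (algebraMap F K).injective
  -- Complete the square in `x ^ 2 = p + q x`.
  refine ⟨x - algebraMap F K (q / 2), p + q ^ 2 / 4, ?_, fun f hf => hx (f + q / 2) ?_, fun z => ?_⟩
  · simp only [map_add, map_div₀, map_pow, map_ofNat]
    linear_combination hpq
  · rw [map_add, hf]
    ring
  · obtain ⟨f, g, rfl⟩ := hrep z
    refine ⟨f + g * q / 2, g, ?_⟩
    simp only [map_add, map_div₀, map_mul, map_ofNat]
    ring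

end Quadratic

/-! ### Primes above ℓ with residue field `𝔽_ℓ`, from embeddings in `ℚ_ℓ` -/

section PadicPrime

variable {ℓ : ℕ} [Fact ℓ.Prime] {F : Type*} [Field F]

theorem Padic.norm_le_one_of_isIntegral (φ : F →+* ℚ_[ℓ]) {x : F} (hx : IsIntegral ℤ x) :
    ‖φ x‖ ≤ 1 := by
  have h1 : IsIntegral ℤ (φ x) := hx.map φ.toIntAlgHom
  obtain ⟨y, hy⟩ := PadicInt.exists_coe_eq_of_isIntegral (h1.tower_top (A := ℤ_[ℓ]))
  rw [← hy]
  exact y.2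

/-- The homomorphism from the integers of `F` to `ℤ_ℓ` induced by an embedding of `F` in `ℚ_ℓ`. -/
noncomputable def ringOfIntegersToPadicInt (φ : F →+* ℚ_[ℓ]) : 𝓞 F →+* ℤ_[ℓ] where
  toFun x := ⟨φ x, Padic.norm_le_one_of_isIntegral φ x.2⟩
  map_one' := Subtype.ext (by simp)
  map_zero' := Subtype.ext (by simp)
  map_add' x y := Subtype.ext ((congrArg φ (map_add _ x y)).trans (map_add φ _ _))
  map_mul' x y := Subtype.ext ((congrArg φ (map_mul _ x y)).trans (map_mul φ _ _))

/-- The prime ideal of the integers of `F` given by an embedding of `F` in `ℚ_ℓ`. -/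
noncomputable def padicPrime (φ : F →+* ℚ_[ℓ]) : Ideal (𝓞 F) :=
  (IsLocalRing.maximalIdeal ℤ_[ℓ]).comap (ringOfIntegersToPadicInt φ)

instance (φ : F →+* ℚ_[ℓ]) : (padicPrime φ).IsPrime := by
  unfold padicPrime
  infer_instance

theorem mem_padicPrime (φ : F →+* ℚ_[ℓ]) (x : 𝓞 F) : x ∈ padicPrime φ ↔ ‖φ x‖ < 1 := by
  rw [padicPrime, Ideal.mem_comap, IsLocalRing.mem_maximalIdeal, PadicInt.mem_nonunits]
  rfl

theorem natCast_mem_padicPrime (φ : F →+* ℚ_[ℓ]) : (ℓ : 𝓞 F) ∈ padicPrime φ := by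
  rw [mem_padicPrime]
  simpa using inv_lt_one_of_one_lt₀ (Nat.one_lt_cast.2 (Fact.out : ℓ.Prime).one_lt)

theorem exists_int_sub_mem_padicPrime (φ : F →+* ℚ_[ℓ]) (x : 𝓞 F) :
    ∃ c : ℤ, x - c ∈ padicPrime φ := by
  obtain ⟨c, hc⟩ := ZMod.intCast_surjective (PadicInt.toZMod (ringOfIntegersToPadicInt φ x))
  refine ⟨c, ?_⟩
  rw [padicPrime, Ideal.mem_comap, ← PadicInt.ker_toZMod, RingHom.mem_ker]
  simp [hc]

end PadicPrime

/-! ### From inertness to irreducibility modulo ℓ -/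

section Inert

variable {ℓ : ℕ} [Fact ℓ.Prime] {F K : Type*} [Field F] [Field K] [Algebra F K] [CharZero F]
  {y : K} {e : F}

theorem IsSqrtGenerator.exists_trace_norm (h : IsSqrtGenerator y e) {f g : F}
    (hz : IsIntegral ℤ (algebraMap F K f + algebraMap F K g * y)) :
    IsIntegral ℤ (2 * f) ∧ IsIntegral ℤ (f ^ 2 - g ^ 2 * e) ∧
      IsIntegral ℤ (algebraMap F K f - algebraMap F K g * y) := by
  obtain ⟨τ, hτ⟩ := h.exists_conj
  have hz' : IsIntegral ℤ (algebraMap F K f - algebraMap F K g * y) := by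
    have := hz.map (τ : K →+* K).toIntAlgHom
    have h2 : (τ : K →+* K).toIntAlgHom (algebraMap F K f + algebraMap F K g * y)
        = algebraMap F K f - algebraMap F K g * y := by
      change τ (algebraMap F K f + algebraMap F K g * y) = _
      rw [map_add, map_mul, AlgEquiv.commutes, AlgEquiv.commutes, hτ]
      ring
    rwa [h2] at this
  have hinj : Function.Injective (algebraMap F K).toIntAlgHom := (algebraMap F K).injective
  refine ⟨(isIntegral_algHom_iff (algebraMap F K).toIntAlgHom hinj).1 ?_,
    (isIntegral_algHom_iff (algebraMap F K).toIntAlgHom hinj).1 ?_, hz'⟩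
  · have h2 : (algebraMap F K).toIntAlgHom (2 * f) =
        (algebraMap F K f + algebraMap F K g * y) + (algebraMap F K f - algebraMap F K g * y) := by
      change algebraMap F K (2 * f) = _
      simp only [map_mul, map_ofNat]
      ring
    exact h2 ▸ hz.add hz'
  · have h2 : (algebraMap F K).toIntAlgHom (f ^ 2 - g ^ 2 * e) =
        (algebraMap F K f + algebraMap F K g * y) * (algebraMap F K f - algebraMap F K g * y) := by
      change algebraMap F K (f ^ 2 - g ^ 2 * e) = _
      simp only [map_sub, map_mul, map_pow, ← h.sq_eq]
      ring
    exact h2 ▸ hz.mul hz'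

omit [CharZero F] in
theorem IsSqrtGenerator.sq_ne_zero (h : IsSqrtGenerator y e) : e ≠ 0 := by
  rintro rfl
  have := h.sq_eq
  rw [map_zero] at this
  exact h.ne_zero (pow_eq_zero_iff (two_ne_zero)|>.1 this)

/-- The residue ring of `𝓞 K` modulo the extended prime is larger than `𝔽_ℓ`. Otherwise `𝓞 K = ℤ + 𝔭
𝓞 K`; the `y`-coordinate kills `ℤ`, and elements of `𝔭` shrink it by a factor ℓ. Iteration makes it
zero on all integers, although a multiple of `y` is integral. -/
theorem exists_sub_intCast_notMem_map_padicPrime (φ : F →+* ℚ_[ℓ]) (hy : IsSqrtGenerator y e)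
    (hK : ∀ z : K, IsAlgebraic ℤ z) :
    ∃ z : 𝓞 K, ∀ c : ℤ, z - c ∉ (padicPrime φ).map (algebraMap (𝓞 F) (𝓞 K)) := by
  by_contra! hcon
  obtain ⟨g, hg0, hg⟩ := hy.exists_linearMap
  set A := ‖φ (4 * e)‖ with hA
  have hA0 : 0 < A := by
    rw [hA, norm_pos_iff, Ne, map_eq_zero]
    exact mul_ne_zero (by exact_mod_cast (four_ne_zero : (4 : ℕ) ≠ 0)) hy.sq_ne_zero
  -- For `z = f + g y`, the element `4 g ^ 2 e = (2 f) ^ 2 - 4 (f ^ 2 - g ^ 2 e)` is integral, being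
  -- built from the trace and the norm. This bounds the `y`-coordinate uniformly.
  have hbound (z : 𝓞 K) : ‖φ (g z)‖ ≤ 1 / A + 1 := by
    obtain ⟨f, hf⟩ := hg z
    have hz : IsIntegral ℤ (z : K) := z.2
    rw [hf] at hz
    obtain ⟨ht, hn, -⟩ := hy.exists_trace_norm hz
    have hint : IsIntegral ℤ ((g z) ^ 2 * (4 * e)) := by
      have h4 : (g z) ^ 2 * (4 * e) = (2 * f) ^ 2 - (f ^ 2 - (g z) ^ 2 * e) * algebraMap ℤ F 4 := by
        simp only [algebraMap_int_eq, eq_intCast, Int.cast_ofNat]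
        ring
      exact h4 ▸ (ht.pow 2).sub (hn.mul isIntegral_algebraMap)
    have h1 := Padic.norm_le_one_of_isIntegral φ hint
    rw [map_mul, map_pow, norm_mul, norm_pow, ← hA] at h1
    rcases le_total ‖φ (g z)‖ 1 with h2 | h2
    · have : 0 < 1 / A := by positivity
      linarith
    · have h3 : ‖φ (g z)‖ ≤ 1 / A := by
        rw [le_div_iff₀ hA0]
        nlinarith
      linarith
  have hl0 : (0 : ℝ) ≤ (ℓ : ℝ)⁻¹ := by positivity
  have hC0 : 0 ≤ 1 / A + 1 := by positivity
  have hind (N : ℕ) : ∀ z : 𝓞 K, ‖φ (g z)‖ ≤ (1 / A + 1) * ((ℓ : ℝ)⁻¹) ^ N := by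
    induction N with
    | zero => simpa using hbound
    | succ N ih =>
      -- The multiplier `k` makes the bound stable under multiplication by `𝓞 K`, as the induction
      -- over the ideal requires.
      have key (w : 𝓞 K) (hw : w ∈ (padicPrime φ).map (algebraMap (𝓞 F) (𝓞 K))) :
          ∀ k : 𝓞 K, ‖φ (g (k * w : 𝓞 K))‖ ≤ (1 / A + 1) * ((ℓ : ℝ)⁻¹) ^ (N + 1) := by
        induction hw using Submodule.span_induction with
        | mem w hw =>
          intro k
          obtain ⟨l, hl, rfl⟩ := hw
          have h1 : g (k * algebraMap (𝓞 F) (𝓞 K) l : 𝓞 K) = (l : F) * g (k : K) := by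
            rw [← smul_eq_mul (l : F), ← map_smul g, Algebra.smul_def]
            exact congrArg g (mul_comm (k : K) (algebraMap F K l))
          have h2 := Padic.norm_le_inv_of_norm_lt_one ((mem_padicPrime φ l).1 hl)
          rw [h1, map_mul, norm_mul, pow_succ']
          calc _ ≤ (ℓ : ℝ)⁻¹ * ((1 / A + 1) * ((ℓ : ℝ)⁻¹) ^ N) :=
                mul_le_mul h2 (ih k) (norm_nonneg _) hl0
            _ = _ := by ring
        | zero =>
          intro k
          simp only [mul_zero, map_zero, norm_zero]
          positivity
        | add a b _ _ ha hb =>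
          intro k
          have : ((k * (a + b) : 𝓞 K) : K) = (k * a : 𝓞 K) + (k * b : 𝓞 K) :=
            congrArg (algebraMap (𝓞 K) K) (mul_add k a b)
          rw [this, map_add, map_add]
          exact (Padic.nonarchimedean _ _).trans (max_le (ha k) (hb k))
        | smul a b _ hb =>
          intro k
          rw [smul_eq_mul, ← mul_assoc]
          exact hb (k * a)
      intro z
      obtain ⟨c, hc⟩ := hcon z
      have := key _ hc 1
      have hcoe : ((1 * (z - c) : 𝓞 K) : K) = z - algebraMap F K c := by
        rw [one_mul, map_intCast]
        exact map_sub (algebraMap (𝓞 K) K) z c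
      rwa [hcoe, map_sub, hg0, sub_zero] at this
  have hl1 : (ℓ : ℝ)⁻¹ < 1 :=
    inv_lt_one_of_one_lt₀ (Nat.one_lt_cast.2 (Fact.out : ℓ.Prime).one_lt)
  have hzero (z : 𝓞 K) : g z = 0 := by
    have hlim := (tendsto_pow_atTop_nhds_zero_of_lt_one hl0 hl1).const_mul (1 / A + 1)
    rw [mul_zero] at hlim
    have := ge_of_tendsto' hlim fun N => hind N z
    simpa using this
  obtain ⟨m, hm0, hm⟩ := (hK y).exists_integral_multiple
  have h0 : g (m • y) = 0 := hzero ⟨_, hm⟩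
  obtain ⟨f, hf⟩ := hg (m • y)
  rw [h0, map_zero, zero_mul, add_zero, zsmul_eq_mul] at hf
  have hK0 : CharZero K := charZero_of_injective_algebraMap (algebraMap F K).injective
  have hm' : (m : K) ≠ 0 := Int.cast_ne_zero.2 hm0
  refine hy.notMem (f / m) ?_
  rw [map_div₀, map_intCast, ← hf]
  field_simp

/-- The polynomial is the characteristic polynomial of an integer `z` not congruent to any rational
integer. A root `k` modulo ℓ would put `(z - k) (w - k)`, with `w` the conjugate of `z`, in the
extended prime, so `z` or `w` would be congruent to `k`. The discriminant of `z = f + g y` is `(2 g)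
^ 2 e`. -/
theorem IsQuadraticInertAbove.exists_residuallyIrreducible (h : IsQuadraticInertAbove ℓ F K)
    (φ : F →+* ℚ_[ℓ]) (hy : IsSqrtGenerator y e) (hK : ∀ z : K, IsAlgebraic ℤ z) :
    ∃ t n : ℤ_[ℓ], ResiduallyIrreducible t n ∧
      ∃ g : F, (t : ℚ_[ℓ]) ^ 2 - 4 * n = φ (2 * g) ^ 2 * φ e := by
  obtain ⟨z, hz⟩ := exists_sub_intCast_notMem_map_padicPrime φ hy hK
  have hP := h.2 (padicPrime φ) inferInstance (natCast_mem_padicPrime φ)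
  set P := (padicPrime φ).map (algebraMap (𝓞 F) (𝓞 K)) with hPdef
  obtain ⟨f, g, hfg⟩ := hy.exists_eq z
  have hzint : IsIntegral ℤ (z : K) := z.2
  rw [hfg] at hzint
  obtain ⟨ht, hn, hz'⟩ := hy.exists_trace_norm hzint
  let t : 𝓞 F := ⟨_, ht⟩
  let n : 𝓞 F := ⟨_, hn⟩
  let w : 𝓞 K := ⟨_, hz'⟩
  have htzw : algebraMap (𝓞 F) (𝓞 K) t = z + w := by
    apply NumberField.RingOfIntegers.ext
    change algebraMap F K (2 * f) = (z : K) + (algebraMap F K f - algebraMap F K g * y)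
    rw [hfg, map_mul, map_ofNat]
    ring
  have hnzw : algebraMap (𝓞 F) (𝓞 K) n = z * w := by
    apply NumberField.RingOfIntegers.ext
    change algebraMap F K (f ^ 2 - g ^ 2 * e) = (z : K) * (algebraMap F K f - algebraMap F K g * y)
    rw [hfg, map_sub, map_mul, map_pow, map_pow, ← hy.sq_eq]
    ring
  refine ⟨ringOfIntegersToPadicInt φ t, ringOfIntegersToPadicInt φ n, fun c => ?_, g, ?_⟩
  · refine le_antisymm (PadicInt.norm_le_one _) (not_lt.1 fun hlt => ?_)
    obtain ⟨k, hk⟩ := ZMod.intCast_surjective (PadicInt.toZMod c)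
    have hmem : (k : 𝓞 F) ^ 2 - t * k + n ∈ padicPrime φ := by
      rw [padicPrime, Ideal.mem_comap, ← PadicInt.ker_toZMod, RingHom.mem_ker]
      have h0 : PadicInt.toZMod
          (c ^ 2 - ringOfIntegersToPadicInt φ t * c + ringOfIntegersToPadicInt φ n) = 0 := by
        by_contra hne
        exact hlt.ne ((PadicInt.norm_eq_one_iff_toZMod_ne_zero _).2 hne)
      simpa [← hk] using h0
    have hmul : (z - k) * (w - k) ∈ P := by
      have := Ideal.mem_map_of_mem (algebraMap (𝓞 F) (𝓞 K)) hmem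
      rw [map_add, map_sub, map_mul, map_pow, map_intCast, htzw, hnzw] at this
      convert this using 1
      ring
    rcases hP.mem_or_mem hmul with h1 | h1
    · exact hz k h1
    -- If `w ≡ k`, then `z = t - w ≡ d - k`, where the integer `d` is congruent to the trace `t`.
    · obtain ⟨d, hd⟩ := exists_int_sub_mem_padicPrime φ t
      refine hz (d - k) ?_
      have := Ideal.mem_map_of_mem (algebraMap (𝓞 F) (𝓞 K)) hd
      rw [map_sub, map_intCast, htzw] at this
      convert P.sub_mem this h1 using 1
      push_cast
      ring
  · change φ (2 * f) ^ 2 - 4 * φ (f ^ 2 - g ^ 2 * e) = _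
    simp only [map_mul, map_sub, map_pow, map_ofNat]
    ring

end Inert

/-! ### From irreducibility modulo ℓ to inertness -/

section Inert

variable {ℓ : ℕ} [Fact ℓ.Prime] {F K : Type*} [Field F] [Field K] [Algebra F K]
  {y : K} {e : F}

instance (φ : F →+* ℚ_[ℓ]) : (padicPrime φ).IsMaximal := by
  have hsurj : Function.Surjective (PadicInt.toZMod.comp (ringOfIntegersToPadicInt φ)) := by
    intro c
    obtain ⟨k, rfl⟩ := ZMod.intCast_surjective c
    exact ⟨k, map_intCast _ k⟩
  have := RingHom.ker_isMaximal_of_surjective _ hsurj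
  rwa [← RingHom.comap_ker, PadicInt.ker_toZMod] at this

/-- An element that is integral at `φ` has a denominator prime to `padicPrime φ`. The denominator is
found in the number field `ℚ(x)`, whose integers form a Dedekind domain. -/
theorem exists_notMem_padicPrime_isIntegral_mul [CharZero F] (φ : F →+* ℚ_[ℓ]) {x : F}
    (hx : ‖φ x‖ ≤ 1) (halg : IsAlgebraic ℤ x) :
    ∃ s : 𝓞 F, s ∉ padicPrime φ ∧ IsIntegral ℤ ((s : F) * x) := by
  have hint : IsIntegral ℚ x := (halg.extendScalars (algebraMap ℤ ℚ).injective_int).isIntegral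
  let k := ℚ⟮x⟯
  have : FiniteDimensional ℚ k := IntermediateField.adjoin.finiteDimensional hint
  have : NumberField k := { }
  let φ' : k →+* ℚ_[ℓ] := φ.comp (algebraMap k F)
  let v : IsDedekindDomain.HeightOneSpectrum (𝓞 k) :=
    ⟨padicPrime φ', inferInstance, fun h => by
      have := natCast_mem_padicPrime φ'
      rw [h, Ideal.mem_bot, Nat.cast_eq_zero] at this
      exact (Fact.out : ℓ.Prime).ne_zero this⟩
  let x' : k := IntermediateField.AdjoinSimple.gen ℚ x
  have hx' : algebraMap k F x' = x := IntermediateField.AdjoinSimple.algebraMap_gen ℚ x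
  have key : ∃ s n : 𝓞 k, s ∉ padicPrime φ' ∧ x' * s = n := by
    obtain ⟨n, ⟨d, hd⟩, hnd | hnd⟩ := v.exists_primeCompl_mul_eq_or_mul_eq x'
    · exact ⟨d, n, hd, hnd⟩
    · refine ⟨n, d, fun hn => hd ?_, hnd⟩
      change d ∈ padicPrime φ'
      rw [mem_padicPrime] at hn ⊢
      have h1 : (d : k) = x' * n := hnd.symm
      rw [h1, map_mul, norm_mul]
      have h2 : ‖φ' x'‖ ≤ 1 := by
        change ‖φ (algebraMap k F x')‖ ≤ 1
        rwa [hx']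
      exact mul_lt_one_of_nonneg_of_lt_one_right h2 (norm_nonneg _) hn
  obtain ⟨s, n, hs, hsn⟩ := key
  refine ⟨algebraMap (𝓞 k) (𝓞 F) s, ?_, ?_⟩
  · rw [mem_padicPrime] at hs ⊢
    exact hs
  · have h1 : ((algebraMap (𝓞 k) (𝓞 F) s : 𝓞 F) : F) * x
        = (algebraMap (𝓞 k) (𝓞 F) n : 𝓞 F) := by
      rw [← hx', mul_comm]
      exact (map_mul (algebraMap k F) x' s).symm.trans (congrArg (algebraMap k F) hsn)
    exact h1 ▸ (algebraMap (𝓞 k) (𝓞 F) n).2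

theorem isIntegral_of_sq_sub_mul_add_eq_zero {t n : F} {u : K} (ht : IsIntegral ℤ t)
    (hn : IsIntegral ℤ n) (hu : u ^ 2 - algebraMap F K t * u + algebraMap F K n = 0) :
    IsIntegral ℤ u := by
  let t' : 𝓞 F := ⟨t, ht⟩
  let n' : 𝓞 F := ⟨n, hn⟩
  have h1 : IsIntegral (𝓞 F) u := by
    refine ⟨Polynomial.X ^ 2 - Polynomial.C t' * Polynomial.X + Polynomial.C n', ?_, ?_⟩
    · monicity!
    · simp only [Polynomial.eval₂_add, Polynomial.eval₂_sub, Polynomial.eval₂_mul,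
        Polynomial.eval₂_pow, Polynomial.eval₂_X, Polynomial.eval₂_C]
      exact hu
  exact isIntegral_trans u h1

/-- Let `P` be a prime over `𝔩 = padicPrime φ` and `z ∈ P`. The norm of `z` lies in `𝔩`, and
`norm_form_eq` then makes both local coordinates of `z` divisible by ℓ. So `z / ℓ` is integral up to
a denominator outside `𝔩`, which is invertible modulo `𝔩`; hence `z ∈ 𝔩 𝓞 K`, and `𝔩 𝓞 K = P`. -/
theorem IsSqrtGenerator.isQuadraticInertAbove [CharZero F] (hy : IsSqrtGenerator y e)
    {t₀ n₀ : ℤ_[ℓ]} (h₀ : ResiduallyIrreducible t₀ n₀) (hF : ∀ x : F, IsAlgebraic ℤ x)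
    (hprime : ∀ 𝔩 : Ideal (𝓞 F), 𝔩.IsPrime → (ℓ : 𝓞 F) ∈ 𝔩 →
      ∃ φ : F →+* ℚ_[ℓ], 𝔩 = padicPrime φ ∧
        ∃ s : ℚ_[ℓ], φ e = s ^ 2 * ((t₀ : ℚ_[ℓ]) ^ 2 - 4 * n₀)) :
    IsQuadraticInertAbove ℓ F K := by
  refine ⟨hy.finrank_eq, fun 𝔩 hp hl => ?_⟩
  obtain ⟨φ, rfl, s, hs⟩ := hprime 𝔩 hp hl
  have hK0 : CharZero K := charZero_of_injective_algebraMap (algebraMap F K).injective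
  obtain ⟨P, hP, hPc⟩ := Ideal.exists_ideal_over_prime_of_isIntegral_of_isDomain
    (S := 𝓞 K) (padicPrime φ) (by
      rw [NumberField.RingOfIntegers.ker_algebraMap_eq_bot]
      exact bot_le)
  suffices h : (padicPrime φ).map (algebraMap (𝓞 F) (𝓞 K)) = P from h ▸ hP
  refine le_antisymm (Ideal.map_le_iff_le_comap.2 hPc.ge) fun z hz => ?_
  obtain ⟨f, g, hfg⟩ := hy.exists_eq z
  have hzint : IsIntegral ℤ (z : K) := z.2
  rw [hfg] at hzint
  obtain ⟨ht, hn, hz'⟩ := hy.exists_trace_norm hzint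
  let n : 𝓞 F := ⟨_, hn⟩
  have hmem : n ∈ padicPrime φ := by
    rw [← hPc, Ideal.mem_comap]
    have : algebraMap (𝓞 F) (𝓞 K) n = z * ⟨_, hz'⟩ := by
      apply NumberField.RingOfIntegers.ext
      change algebraMap F K (f ^ 2 - g ^ 2 * e)
        = (z : K) * (algebraMap F K f - algebraMap F K g * y)
      rw [hfg, map_sub, map_mul, map_pow, map_pow, ← hy.sq_eq]
      ring
    rw [this]
    exact P.mul_mem_right _ hz
  rw [mem_padicPrime] at hmem
  replace hmem : ‖φ (f ^ 2 - g ^ 2 * e)‖ < 1 := hmem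
  -- With `α` a root of `X ^ 2 - t₀ X + n₀`, `y` corresponds to `s (2 α - t₀)`, so `z = f + g y`
  -- corresponds to `a + b α`.
  set b := 2 * φ g * s with hb
  set a := φ f - φ g * s * t₀ with ha
  have hform : φ (f ^ 2 - g ^ 2 * e) = a ^ 2 + t₀ * a * b + n₀ * b ^ 2 := by
    rw [map_sub, map_mul, map_pow, map_pow, hs, ha, hb]
    ring
  have htr : φ (2 * f) = 2 * a + t₀ * b := by
    rw [map_mul, map_ofNat, ha, hb]
    ring
  have hmax : ‖φ (f ^ 2 - g ^ 2 * e)‖ = max ‖a‖ ‖b‖ ^ 2 := by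
    rw [hform, h₀.norm_form_eq]
  have hlt : max ‖a‖ ‖b‖ < 1 := by
    rw [hmax] at hmem
    exact lt_of_not_ge fun h => absurd (one_le_pow₀ h (n := 2)) (not_le.2 hmem)
  have hle : max ‖a‖ ‖b‖ ≤ (ℓ : ℝ)⁻¹ := max_le
    (Padic.norm_le_inv_of_norm_lt_one ((le_max_left _ _).trans_lt hlt))
    (Padic.norm_le_inv_of_norm_lt_one ((le_max_right _ _).trans_lt hlt))
  have hl0 : (0 : ℝ) < ℓ := Nat.cast_pos.2 (Fact.out : ℓ.Prime).pos
  have hlF : (ℓ : F) ≠ 0 := Nat.cast_ne_zero.2 (Fact.out : ℓ.Prime).ne_zero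
  have hlK : (ℓ : K) ≠ 0 := Nat.cast_ne_zero.2 (Fact.out : ℓ.Prime).ne_zero
  have hnl : ‖φ (ℓ : F)‖ = (ℓ : ℝ)⁻¹ := by
    rw [map_natCast]
    exact Padic.norm_p
  have ht1 : ‖φ (2 * f / ℓ)‖ ≤ 1 := by
    rw [map_div₀, norm_div, hnl, htr]
    refine div_le_one_of_le₀ ?_ (by positivity)
    refine (Padic.nonarchimedean _ _).trans (max_le ?_ ?_)
    · rw [norm_mul]
      have h2 : ‖(2 : ℚ_[ℓ])‖ ≤ 1 := by exact_mod_cast Padic.norm_int_le_one (p := ℓ) 2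
      exact (mul_le_of_le_one_left (norm_nonneg _) h2).trans ((le_max_left _ _).trans hle)
    · rw [norm_mul]
      exact (mul_le_of_le_one_left (norm_nonneg _) t₀.2).trans ((le_max_right _ _).trans hle)
  have hn1 : ‖φ ((f ^ 2 - g ^ 2 * e) / ℓ ^ 2)‖ ≤ 1 := by
    rw [map_div₀, norm_div, map_pow, norm_pow, hnl, hmax]
    refine div_le_one_of_le₀ ?_ (by positivity)
    exact pow_le_pow_left₀ ((norm_nonneg _).trans (le_max_left _ _)) hle 2
  obtain ⟨s₁, hs₁, hi₁⟩ := exists_notMem_padicPrime_isIntegral_mul φ ht1 (hF _)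
  obtain ⟨s₂, hs₂, hi₂⟩ := exists_notMem_padicPrime_isIntegral_mul φ hn1 (hF _)
  have hs₁₂ : s₁ * s₂ ∉ padicPrime φ := fun h => (hp.mem_or_mem h).elim hs₁ hs₂
  -- The factors `s₁` and `s₂` clear the denominators of the trace and of the norm of `z / ℓ`.
  have hu : IsIntegral ℤ (algebraMap F K (s₁ * s₂ : 𝓞 F) * z / ℓ) := by
    refine isIntegral_of_sq_sub_mul_add_eq_zero (t := (s₂ : F) * (s₁ * (2 * f / ℓ)))
      (n := (s₁ : F) ^ 2 * s₂ * (s₂ * ((f ^ 2 - g ^ 2 * e) / ℓ ^ 2))) (s₂.2.mul hi₁)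
      (((s₁.2.pow 2).mul s₂.2).mul hi₂) ?_
    have h1 : ((s₁ * s₂ : 𝓞 F) : F) = s₁ * s₂ := map_mul (algebraMap (𝓞 F) F) s₁ s₂
    rw [h1, hfg]
    simp only [map_mul, map_pow, map_div₀, map_sub, map_natCast, map_ofNat, ← hy.sq_eq]
    field_simp
    ring
  have hsz : algebraMap (𝓞 F) (𝓞 K) (s₁ * s₂) * z
      ∈ (padicPrime φ).map (algebraMap (𝓞 F) (𝓞 K)) := by
    have h1 : algebraMap (𝓞 F) (𝓞 K) (s₁ * s₂) * z = ⟨_, hu⟩ * algebraMap (𝓞 F) (𝓞 K) ℓ := by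
      apply NumberField.RingOfIntegers.ext
      change algebraMap F K (s₁ * s₂ : 𝓞 F) * (z : K)
        = (algebraMap F K (s₁ * s₂ : 𝓞 F) * z / ℓ) * algebraMap F K ((ℓ : 𝓞 F) : F)
      have h2 : ((ℓ : 𝓞 F) : F) = ℓ := map_natCast (algebraMap (𝓞 F) F) ℓ
      rw [h2, map_natCast]
      field_simp
    rw [h1]
    exact Ideal.mul_mem_left _ _ (Ideal.mem_map_of_mem _ hl)
  obtain ⟨r, i, hi, hri⟩ :=
    Ideal.IsMaximal.exists_inv (inferInstanceAs (padicPrime φ).IsMaximal) hs₁₂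
  have h1 := congrArg (algebraMap (𝓞 F) (𝓞 K)) hri
  rw [map_add, map_mul, map_one] at h1
  have h2 : z = algebraMap (𝓞 F) (𝓞 K) r * (algebraMap (𝓞 F) (𝓞 K) (s₁ * s₂) * z)
      + z * algebraMap (𝓞 F) (𝓞 K) i := by linear_combination -z * h1
  rw [h2]
  exact Ideal.add_mem _ (Ideal.mul_mem_left _ _ hsz)
    (Ideal.mul_mem_left _ _ (Ideal.mem_map_of_mem _ hi))

end Inert

/-! ### Every prime above ℓ of a totally ℓ-adic field comes from an embedding -/

section Transitivity

variable {Qbar : Type*} [Field Qbar] [Algebra ℚ Qbar] [IsAlgClosure ℚ Qbar]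

theorem isGalois_of_isAlgClosure_rat : IsGalois ℚ Qbar := by
  have : Algebra.IsAlgebraic ℚ Qbar := IsAlgClosure.isAlgebraic
  have : IsAlgClosed Qbar := IsAlgClosure.isAlgClosed ℚ
  exact { }

open scoped Pointwise in
theorem exists_smul_eq_of_mem {ℓ : ℕ} (hl : ℓ.Prime) (P Q : Ideal (𝓞 Qbar)) [P.IsPrime] [Q.IsPrime]
    (hP : (ℓ : 𝓞 Qbar) ∈ P) (hQ : (ℓ : 𝓞 Qbar) ∈ Q) :
    ∃ σ : Qbar ≃ₐ[ℚ] Qbar, Q = σ • P := by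
  have : IsGalois ℚ Qbar := isGalois_of_isAlgClosure_rat
  -- Stabilizers are open because each integer has finite degree, so the profinite Galois group acts
  -- continuously on the discrete ring `𝓞 Qbar`.
  let _ : TopologicalSpace (𝓞 Qbar) := ⊥
  have : DiscreteTopology (𝓞 Qbar) := ⟨rfl⟩
  have : ContinuousSMul (Qbar ≃ₐ[ℚ] Qbar) (𝓞 Qbar) := by
    rw [continuousSMul_iff_stabilizer_isOpen]
    intro x
    convert stabilizer_isOpen_of_isIntegral (K := ℚ) (x : Qbar) using 1
    ext σ
    simp only [SetLike.mem_coe, MulAction.mem_stabilizer_iff]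
    exact NumberField.RingOfIntegers.ext_iff
  have : SMulCommClass (Qbar ≃ₐ[ℚ] Qbar) ℤ (𝓞 Qbar) := ⟨fun σ m x =>
    map_zsmul (DistribSMul.toAddMonoidHom (𝓞 Qbar) σ) m x⟩
  have : Algebra.IsInvariant ℤ (𝓞 Qbar) (Qbar ≃ₐ[ℚ] Qbar) := by
    refine ⟨fun b hb => ?_⟩
    obtain ⟨q, hq⟩ := (InfiniteGalois.mem_range_algebraMap_iff_fixed (k := ℚ) (b : Qbar)).2
      fun σ => NumberField.RingOfIntegers.ext_iff.1 (hb σ)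
    have hint : IsIntegral ℤ q := by
      have h1 : IsIntegral ℤ (b : Qbar) := b.2
      rw [← hq] at h1
      exact (isIntegral_algHom_iff (algebraMap ℚ Qbar).toIntAlgHom
        (algebraMap ℚ Qbar).injective).1 h1
    obtain ⟨m, hm⟩ := IsIntegrallyClosed.isIntegral_iff.1 hint
    refine ⟨m, NumberField.RingOfIntegers.ext ?_⟩
    rw [← hq, ← hm]
    simp
  have hunder (P : Ideal (𝓞 Qbar)) [P.IsPrime] (hP : (ℓ : 𝓞 Qbar) ∈ P) :
      P.under ℤ = Ideal.span {(ℓ : ℤ)} := by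
    have hmax : (Ideal.span {(ℓ : ℤ)}).IsMaximal :=
      PrincipalIdealRing.isMaximal_of_irreducible (Nat.prime_iff_prime_int.1 hl).irreducible
    refine (hmax.eq_of_le (Ideal.IsPrime.under ℤ P).ne_top ?_).symm
    rw [Ideal.span_singleton_le_iff_mem, Ideal.mem_comap]
    simpa using hP
  exact Algebra.IsInvariant.exists_smul_of_under_eq_of_profinite (A := ℤ)
    (G := Qbar ≃ₐ[ℚ] Qbar) P Q ((hunder P hP).trans (hunder Q hQ).symm)

variable {ℓ : ℕ} [Fact ℓ.Prime]

omit [IsAlgClosure ℚ Qbar] in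
theorem IsTotallyLadic.exists_ringHom {ι : Qbar →+* AlgebraicClosure ℚ_[ℓ]}
    {F : IntermediateField ℚ Qbar} (hF : IsTotallyLadic ι F) (σ : Qbar ≃ₐ[ℚ] Qbar) :
    ∃ φ : F →+* ℚ_[ℓ], ∀ x : F, algebraMap ℚ_[ℓ] (AlgebraicClosure ℚ_[ℓ]) (φ x) = ι (σ x) := by
  have h (x : F) : ∃ c : ℚ_[ℓ], algebraMap ℚ_[ℓ] (AlgebraicClosure ℚ_[ℓ]) c = ι (σ x) :=
    (mem_ladicSubfield ι _).1 (hF σ ⟨x, x.2, rfl⟩)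
  choose φ hφ using h
  have hinj := (algebraMap ℚ_[ℓ] (AlgebraicClosure ℚ_[ℓ])).injective
  exact ⟨{ toFun := φ
           map_one' := hinj (by simp [hφ])
           map_zero' := hinj (by simp [hφ])
           map_add' := fun x y => hinj (by simp [hφ])
           map_mul' := fun x y => hinj (by simp [hφ]) }, hφ⟩

omit [Algebra ℚ Qbar] [IsAlgClosure ℚ Qbar] in
theorem exists_isPrime_of_ringHom (ι : Qbar →+* AlgebraicClosure ℚ_[ℓ]) :
    ∃ 𝔏 : Ideal (𝓞 Qbar), 𝔏.IsPrime ∧ ∀ (x : 𝓞 Qbar) (c : ℚ_[ℓ]),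
      algebraMap ℚ_[ℓ] (AlgebraicClosure ℚ_[ℓ]) c = ι x → (x ∈ 𝔏 ↔ ‖c‖ < 1) := by
  let A := integralClosure ℤ_[ℓ] (AlgebraicClosure ℚ_[ℓ])
  have hinj : Function.Injective (algebraMap ℤ_[ℓ] (AlgebraicClosure ℚ_[ℓ])) := by
    rw [IsScalarTower.algebraMap_eq ℤ_[ℓ] ℚ_[ℓ]]
    exact (algebraMap ℚ_[ℓ] _).injective.comp (IsFractionRing.injective ℤ_[ℓ] ℚ_[ℓ])
  have hinjA : Function.Injective (algebraMap ℤ_[ℓ] A) := fun a b hab =>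
    hinj (congrArg (Subtype.val : A → AlgebraicClosure ℚ_[ℓ]) hab)
  obtain ⟨M, hM, hMc⟩ := Ideal.exists_ideal_over_prime_of_isIntegral_of_isDomain
    (S := A) (IsLocalRing.maximalIdeal ℤ_[ℓ]) (by
      rw [(RingHom.injective_iff_ker_eq_bot _).1 hinjA]
      exact bot_le)
  let r : 𝓞 Qbar →+* A := (ι.comp (algebraMap (𝓞 Qbar) Qbar)).codRestrict A fun x =>
    ((x.2 : IsIntegral ℤ (x : Qbar)).map ι.toIntAlgHom).tower_top
  refine ⟨M.comap r, hM.comap r, fun x c hc => ?_⟩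
  have hcint : IsIntegral ℤ_[ℓ] c := by
    have h1 : IsIntegral ℤ_[ℓ] (ι x) :=
      ((x.2 : IsIntegral ℤ (x : Qbar)).map ι.toIntAlgHom).tower_top
    rw [← hc] at h1
    exact (isIntegral_algebraMap_iff (algebraMap ℚ_[ℓ] (AlgebraicClosure ℚ_[ℓ])).injective).1 h1
  obtain ⟨c', rfl⟩ := PadicInt.exists_coe_eq_of_isIntegral hcint
  have hr : r x = algebraMap ℤ_[ℓ] A c' := by
    apply Subtype.ext
    change ι x = algebraMap ℤ_[ℓ] (AlgebraicClosure ℚ_[ℓ]) c'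
    rw [← hc, IsScalarTower.algebraMap_apply ℤ_[ℓ] ℚ_[ℓ]]
    rfl
  rw [Ideal.mem_comap, hr, ← Ideal.mem_comap, hMc, IsLocalRing.mem_maximalIdeal,
    PadicInt.mem_nonunits]
  rfl

/-- Lift `𝔩` to a prime of `𝓞 Qbar` and move it by some `σ` to the prime defined by `ι`; the
embedding is then `ι ∘ σ` on `F`. -/
theorem IsTotallyLadic.exists_padicPrime_eq {ι : Qbar →+* AlgebraicClosure ℚ_[ℓ]}
    {F : IntermediateField ℚ Qbar} (hF : IsTotallyLadic ι F) (𝔩 : Ideal (𝓞 F)) (hp : 𝔩.IsPrime)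
    (hl : (ℓ : 𝓞 F) ∈ 𝔩) :
    ∃ (σ : Qbar ≃ₐ[ℚ] Qbar) (φ : F →+* ℚ_[ℓ]),
      (∀ x : F, algebraMap ℚ_[ℓ] (AlgebraicClosure ℚ_[ℓ]) (φ x) = ι (σ x)) ∧
        𝔩 = padicPrime φ := by
  have hGal : IsGalois ℚ Qbar := isGalois_of_isAlgClosure_rat
  have : Algebra.IsAlgebraic F Qbar := Algebra.IsAlgebraic.tower_top (K := ℚ) F
  obtain ⟨𝔏, h𝔏, h⟩ := exists_isPrime_of_ringHom ι
  obtain ⟨Q, hQ, hQc⟩ := Ideal.exists_ideal_over_prime_of_isIntegral_of_isDomain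
    (S := 𝓞 Qbar) 𝔩 (by
      rw [NumberField.RingOfIntegers.ker_algebraMap_eq_bot]
      exact bot_le)
  have hlQ : (ℓ : 𝓞 Qbar) ∈ Q := by
    rw [← hQc, Ideal.mem_comap, map_natCast] at hl
    exact hl
  have hl𝔏 : (ℓ : 𝓞 Qbar) ∈ 𝔏 := by
    refine (h ℓ ℓ ?_).2 ?_
    · have : ((ℓ : 𝓞 Qbar) : Qbar) = ℓ := map_natCast (algebraMap (𝓞 Qbar) Qbar) ℓ
      rw [this, map_natCast, map_natCast]
    · simpa using inv_lt_one_of_one_lt₀ (Nat.one_lt_cast.2 (Fact.out : ℓ.Prime).one_lt)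
  obtain ⟨σ, hσ⟩ := exists_smul_eq_of_mem Fact.out Q 𝔏 hlQ hl𝔏
  obtain ⟨φ, hφ⟩ := hF.exists_ringHom σ
  refine ⟨σ, φ, hφ, ?_⟩
  ext x
  rw [mem_padicPrime, ← hQc, Ideal.mem_comap, ← Ideal.smul_mem_pointwise_smul_iff (a := σ), ← hσ]
  exact h _ _ (hφ x)

end Transitivity

/-! ### Adjoining a square root to an intermediate field -/

section SqrtAdjoin

variable {k L : Type*} [Field k] [Field L] [Algebra k L]

/-- The intermediate field `F + F * b`, for `b ^ 2` in `F`. -/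
def IntermediateField.sqrtAdjoin (F : IntermediateField k L) (b : L) (hb : b ^ 2 ∈ F) :
    IntermediateField k L where
  carrier := {x | ∃ f ∈ F, ∃ g ∈ F, x = f + g * b}
  mul_mem' := by
    rintro _ _ ⟨f, hf, g, hg, rfl⟩ ⟨f', hf', g', hg', rfl⟩
    exact ⟨f * f' + g * g' * b ^ 2, add_mem (mul_mem hf hf') (mul_mem (mul_mem hg hg') hb),
      f * g' + g * f', add_mem (mul_mem hf hg') (mul_mem hg hf'), by ring⟩
  add_mem' := by
    rintro _ _ ⟨f, hf, g, hg, rfl⟩ ⟨f', hf', g', hg', rfl⟩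
    exact ⟨f + f', add_mem hf hf', g + g', add_mem hg hg', by ring⟩
  algebraMap_mem' x := ⟨algebraMap k L x, F.algebraMap_mem x, 0, F.zero_mem, by simp⟩
  inv_mem' := by
    rintro _ ⟨f, hf, g, hg, rfl⟩
    by_cases hbF : b ∈ F
    · exact ⟨(f + g * b)⁻¹, inv_mem (add_mem hf (mul_mem hg hbF)), 0, F.zero_mem, by simp⟩
    by_cases hg0 : g = 0
    · subst hg0
      exact ⟨f⁻¹, inv_mem hf, 0, F.zero_mem, by simp⟩
    have h1 : f + g * b ≠ 0 := fun h => hbF <| by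
      have : b = -f / g := by
        field_simp
        linear_combination h
      exact this ▸ div_mem (neg_mem hf) hg
    have h2 : f - g * b ≠ 0 := fun h => hbF <| by
      have : b = f / g := by
        field_simp
        linear_combination -h
      exact this ▸ div_mem hf hg
    have h3 : f ^ 2 - g ^ 2 * b ^ 2 ≠ 0 := by
      have : f ^ 2 - g ^ 2 * b ^ 2 = (f + g * b) * (f - g * b) := by ring
      exact this ▸ mul_ne_zero h1 h2
    have h4 : f ^ 2 - g ^ 2 * b ^ 2 ∈ F := sub_mem (pow_mem hf 2) (mul_mem (pow_mem hg 2) hb)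
    refine ⟨f / (f ^ 2 - g ^ 2 * b ^ 2), div_mem hf h4, -g / (f ^ 2 - g ^ 2 * b ^ 2),
      div_mem (neg_mem hg) h4, ?_⟩
    field_simp
    ring

theorem IntermediateField.mem_sqrtAdjoin {F : IntermediateField k L} {b : L} {hb : b ^ 2 ∈ F}
    {x : L} : x ∈ F.sqrtAdjoin b hb ↔ ∃ f ∈ F, ∃ g ∈ F, x = f + g * b := Iff.rfl

theorem IntermediateField.le_sqrtAdjoin (F : IntermediateField k L) (b : L) (hb : b ^ 2 ∈ F) :
    F ≤ F.sqrtAdjoin b hb := fun x hx => ⟨x, hx, 0, F.zero_mem, by simp⟩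

theorem IntermediateField.self_mem_sqrtAdjoin (F : IntermediateField k L) (b : L)
    (hb : b ^ 2 ∈ F) : b ∈ F.sqrtAdjoin b hb := ⟨0, F.zero_mem, 1, F.one_mem, by simp⟩

end SqrtAdjoin

/-! ### The square root `δ` and inert quadratic extensions -/

section Global

variable {ℓ : ℕ} [Fact ℓ.Prime] {Qbar : Type*} [Field Qbar] [Algebra ℚ Qbar] [IsAlgClosure ℚ Qbar]
  {ι : Qbar →+* AlgebraicClosure ℚ_[ℓ]}

theorem mem_maxTotallyLadic {x : Qbar} :
    x ∈ maxTotallyLadic ι ↔ ∀ σ : Qbar ≃ₐ[ℚ] Qbar, σ x ∈ ladicSubfield ι := by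
  constructor
  · intro hx σ
    exact (isGreatest_maxTotallyLadic ι).1 σ ⟨x, hx, rfl⟩
  · intro hx
    have hle : IsTotallyLadic ι ℚ⟮x⟯ := by
      intro σ
      rw [IntermediateField.map_le_iff_le_comap, IntermediateField.adjoin_simple_le_iff]
      exact hx σ
    exact (isGreatest_maxTotallyLadic ι).2 hle (IntermediateField.mem_adjoin_simple_self ℚ x)

theorem IsTotallyLadic.le_maxTotallyLadic {F : IntermediateField ℚ Qbar}
    (hF : IsTotallyLadic ι F) : F ≤ maxTotallyLadic ι :=
  (isGreatest_maxTotallyLadic ι).2 hF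

theorem isTotallyLadic_of_le {F : IntermediateField ℚ Qbar} (hF : F ≤ maxTotallyLadic ι) :
    IsTotallyLadic ι F := fun σ =>
  (IntermediateField.map_mono _ hF).trans ((isGreatest_maxTotallyLadic ι).1 σ)

theorem map_mem_maxTotallyLadic {x : Qbar} (hx : x ∈ maxTotallyLadic ι) (σ : Qbar ≃ₐ[ℚ] Qbar) :
    σ x ∈ maxTotallyLadic ι :=
  mem_maxTotallyLadic.2 fun τ => mem_maxTotallyLadic.1 hx (σ.trans τ)

theorem maxTotallyLadic_le_ladicSubfield : maxTotallyLadic ι ≤ ladicSubfield ι := fun _ hx =>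
  mem_maxTotallyLadic.1 hx AlgEquiv.refl

theorem isAlgebraic_int_intermediateField (F : IntermediateField ℚ Qbar) (x : F) :
    IsAlgebraic ℤ x := by
  have : Algebra.IsAlgebraic ℚ Qbar := IsAlgClosure.isAlgebraic
  have h1 : IsAlgebraic ℚ (x : Qbar) := Algebra.IsAlgebraic.isAlgebraic _
  have h2 : IsAlgebraic ℤ (x : Qbar) := (IsFractionRing.isAlgebraic_iff ℤ ℚ Qbar).2 h1
  exact (isAlgebraic_algHom_iff (algebraMap F Qbar).toIntAlgHom (algebraMap F Qbar).injective).1 h2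

theorem PadicInt.coe_intCast_discrim (t n : ℤ) :
    (((t : ℤ_[ℓ]) : ℚ_[ℓ]) ^ 2 - 4 * ((n : ℤ_[ℓ]) : ℚ_[ℓ])) = ((t ^ 2 - 4 * n : ℤ) : ℚ_[ℓ]) := by
  push_cast
  rfl

/-- `δ` is a square root of the discriminant of an integral polynomial of degree two that is
irreducible modulo `ℓ`. -/
structure IsInertSqrt (ℓ : ℕ) [Fact ℓ.Prime] {L : Type*} [Field L] (δ : L) : Prop where
  exists_eq : ∃ t n : ℤ, ResiduallyIrreducible (t : ℤ_[ℓ]) (n : ℤ_[ℓ]) ∧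
    δ ^ 2 = ((t ^ 2 - 4 * n : ℤ) : L)

variable (ℓ) (Qbar) in
omit [Algebra ℚ Qbar] [IsAlgClosure ℚ Qbar] in
theorem exists_isInertSqrt [IsAlgClosed Qbar] : ∃ δ : Qbar, IsInertSqrt ℓ δ := by
  obtain ⟨t, n, h⟩ := exists_residuallyIrreducible ℓ
  obtain ⟨δ, hδ⟩ := IsAlgClosed.exists_pow_nat_eq ((t ^ 2 - 4 * n : ℤ) : Qbar) two_pos
  exact ⟨δ, ⟨t, n, h, hδ⟩⟩

namespace IsInertSqrt

variable {δ : Qbar}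

omit [IsAlgClosure ℚ Qbar] in
theorem notMem_ladicSubfield (h : IsInertSqrt ℓ δ) : δ ∉ ladicSubfield ι := by
  obtain ⟨t, n, hr, hδ⟩ := h.exists_eq
  rw [mem_ladicSubfield]
  rintro ⟨c, hc⟩
  refine hr.not_isSquare ⟨c, (algebraMap ℚ_[ℓ] (AlgebraicClosure ℚ_[ℓ])).injective ?_⟩
  rw [map_mul, hc, ← sq, ← map_pow, hδ, PadicInt.coe_intCast_discrim, map_intCast, map_intCast]

theorem notMem_maxTotallyLadic (h : IsInertSqrt ℓ δ) : δ ∉ maxTotallyLadic ι := fun h' =>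
  h.notMem_ladicSubfield (maxTotallyLadic_le_ladicSubfield h')

omit [IsAlgClosure ℚ Qbar] in
theorem sq_mem (h : IsInertSqrt ℓ δ) (F : IntermediateField ℚ Qbar) : δ ^ 2 ∈ F := by
  obtain ⟨t, n, -, hδ⟩ := h.exists_eq
  exact hδ ▸ intCast_mem F _

omit [IsAlgClosure ℚ Qbar] in
theorem map_eq_or (h : IsInertSqrt ℓ δ) (σ : Qbar ≃ₐ[ℚ] Qbar) : σ δ = δ ∨ σ δ = -δ := by
  obtain ⟨t, n, -, hδ⟩ := h.exists_eq
  rw [← sq_eq_sq_iff_eq_or_eq_neg, ← map_pow, hδ, map_intCast]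

theorem exists_conj (h : IsInertSqrt ℓ δ) :
    ∃ τ : Qbar ≃ₐ[ℚ] Qbar, (∀ x ∈ maxTotallyLadic ι, τ x = x) ∧ τ δ = -δ := by
  have : IsGalois ℚ Qbar := isGalois_of_isAlgClosure_rat
  have : IsGalois (maxTotallyLadic ι) Qbar := IsGalois.tower_top_of_isGalois ℚ _ Qbar
  have h1 : δ ∉ Set.range (algebraMap (maxTotallyLadic ι) Qbar) := by
    rintro ⟨x, rfl⟩
    exact h.notMem_maxTotallyLadic x.2
  rw [InfiniteGalois.mem_range_algebraMap_iff_fixed] at h1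
  push Not at h1
  obtain ⟨τ, hτ⟩ := h1
  refine ⟨τ.restrictScalars ℚ, fun x hx => τ.commutes ⟨x, hx⟩, ?_⟩
  exact (h.map_eq_or (τ.restrictScalars ℚ)).resolve_left hτ

/-- Under each embedding `φ`, inertness makes `φ e` a square times a discriminant irreducible modulo
ℓ. By `exists_sq_eq_mul`, its product with `δ ^ 2` is a square in `ℚ_ℓ`, so every conjugate of `y δ`
lies in `ℚ_ℓ`. -/
theorem exists_mul_mem_maxTotallyLadic (h : IsInertSqrt ℓ δ) {F K : IntermediateField ℚ Qbar}
    (hFK : F ≤ K) (hF : IsTotallyLadic ι F)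
    (hK : IsQuadraticInertAbove ℓ F (IntermediateField.extendScalars hFK)) :
    ∃ y ∈ K, y ≠ 0 ∧ y * δ ∈ maxTotallyLadic ι ∧ ∀ x ∈ K, ∃ f ∈ F, ∃ g ∈ F, x = f + g * y := by
  obtain ⟨t, n, hr, hδ⟩ := h.exists_eq
  obtain ⟨y, e, hy⟩ := exists_isSqrtGenerator hK.1
  have hye : (y : Qbar) ^ 2 = (e : Qbar) := congrArg Subtype.val hy.sq_eq
  refine ⟨y, y.2, fun h0 => hy.ne_zero (Subtype.ext h0), ?_, fun x hx => ?_⟩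
  · rw [mem_maxTotallyLadic]
    intro σ
    obtain ⟨φ, hφ⟩ := hF.exists_ringHom σ
    obtain ⟨t', n', hr', g, hg⟩ := hK.exists_residuallyIrreducible φ hy
      fun z => isAlgebraic_int_intermediateField K ⟨z, z.2⟩
    obtain ⟨s, hs⟩ := hr'.exists_sq_eq_mul hr
    have hs' : (s : ℚ_[ℓ]) ^ 2
        = ((t' : ℚ_[ℓ]) ^ 2 - 4 * n') * (((t : ℤ_[ℓ]) : ℚ_[ℓ]) ^ 2 - 4 * ((n : ℤ_[ℓ]) : ℚ_[ℓ])) :=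
      congrArg (Subtype.val : ℤ_[ℓ] → ℚ_[ℓ]) hs
    have hg0 : φ (2 * g) ≠ 0 := by
      intro h0
      apply hr'.not_isSquare
      rw [hg, h0]
      exact ⟨0, by ring⟩
    rw [hg] at hs'
    have hsq : (ι (σ (y * δ))) ^ 2
        = (algebraMap ℚ_[ℓ] (AlgebraicClosure ℚ_[ℓ]) (s / φ (2 * g))) ^ 2 := by
      rw [← map_pow, ← map_pow, mul_pow, hye, hδ, map_mul, map_mul, ← hφ, ← map_pow, div_pow, hs']
      have h1 : ι (σ ((t ^ 2 - 4 * n : ℤ) : Qbar)) = algebraMap ℚ_[ℓ] (AlgebraicClosure ℚ_[ℓ])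
          (((t : ℤ_[ℓ]) : ℚ_[ℓ]) ^ 2 - 4 * ((n : ℤ_[ℓ]) : ℚ_[ℓ])) := by
        rw [PadicInt.coe_intCast_discrim, map_intCast, map_intCast, map_intCast]
      rw [h1, ← map_mul]
      congr 1
      field_simp
    rw [mem_ladicSubfield]
    rcases sq_eq_sq_iff_eq_or_eq_neg.1 hsq with h1 | h1
    · exact ⟨_, h1.symm⟩
    · exact ⟨-(s / φ (2 * g)), by rw [h1, map_neg]⟩
  · obtain ⟨f, g, hfg⟩ := hy.exists_eq ⟨x, hx⟩
    exact ⟨f, f.2, g, g.2, congrArg Subtype.val hfg⟩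

theorem isQuadraticInertAbove (h : IsInertSqrt ℓ δ) {F K : IntermediateField ℚ Qbar}
    (hFK : F ≤ K) (hF : F ≤ maxTotallyLadic ι) {y : Qbar} (hyK : y ∈ K) (hy0 : y ≠ 0)
    (hyF : y ^ 2 ∈ F) (hyδ : y * δ ∈ maxTotallyLadic ι)
    (hK : ∀ x ∈ K, ∃ f ∈ F, ∃ g ∈ F, x = f + g * y) :
    IsQuadraticInertAbove ℓ F (IntermediateField.extendScalars hFK) := by
  obtain ⟨t, n, hr, hδ⟩ := h.exists_eq
  have hy : IsSqrtGenerator (F := F) (⟨y, hyK⟩ : IntermediateField.extendScalars hFK)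
      ⟨y ^ 2, hyF⟩ := by
    refine ⟨rfl, fun f hf => ?_, fun z => ?_⟩
    -- If `y` were in `F`, then `δ = y δ / y` would be totally ℓ-adic.
    · have hfy : (f : Qbar) = y := congrArg Subtype.val hf
      have h1 : y ∈ maxTotallyLadic ι := hfy ▸ hF f.2
      apply h.notMem_maxTotallyLadic
      exact mul_div_cancel_left₀ δ hy0 ▸ div_mem hyδ h1
    · obtain ⟨f, hf, g, hg, hz⟩ := hK z z.2
      exact ⟨⟨f, hf⟩, ⟨g, hg⟩, Subtype.ext hz⟩
  refine hy.isQuadraticInertAbove hr (isAlgebraic_int_intermediateField F) fun 𝔩 hp hl => ?_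
  obtain ⟨σ, φ, hφ, hlφ⟩ := (isTotallyLadic_of_le hF).exists_padicPrime_eq 𝔩 hp hl
  refine ⟨φ, hlφ, ?_⟩
  obtain ⟨c, hc⟩ := (mem_ladicSubfield ι _).1 (mem_maxTotallyLadic.1 hyδ σ)
  have hΔ : ((t ^ 2 - 4 * n : ℤ) : ℚ_[ℓ]) ≠ 0 := fun h0 =>
    hr.not_isSquare ⟨0, by rw [PadicInt.coe_intCast_discrim, h0, zero_mul]⟩
  refine ⟨c / ((t ^ 2 - 4 * n : ℤ) : ℚ_[ℓ]), ?_⟩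
  have h1 : φ ⟨y ^ 2, hyF⟩ * ((t ^ 2 - 4 * n : ℤ) : ℚ_[ℓ]) = c ^ 2 := by
    apply (algebraMap ℚ_[ℓ] (AlgebraicClosure ℚ_[ℓ])).injective
    rw [map_mul, hφ, map_pow _ c, hc, ← map_pow ι, ← map_pow σ, mul_pow, hδ, map_mul, map_mul,
      map_intCast, map_intCast, map_intCast]
  rw [PadicInt.coe_intCast_discrim, eq_div_of_mul_eq hΔ h1]
  field_simp

end IsInertSqrt

end Global

theorem IntermediateField.normalClosure_spec {k L : Type*} [Field k] [Field L] [Algebra k L]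
    [Normal k L] {K M : IntermediateField k L} (hM : ∀ σ : L ≃ₐ[k] L, ∀ x ∈ M, σ x ∈ M)
    (hKM : K ≤ M) :
    K ≤ normalClosure k K L ∧ normalClosure k K L ≤ M ∧
      ∀ σ : L ≃ₐ[k] L, ∀ x ∈ normalClosure k K L, σ x ∈ normalClosure k K L := by
  have : Normal k M := by
    rw [normal_iff_forall_map_le']
    rintro σ _ ⟨x, hx, rfl⟩
    exact hM σ x hx
  refine ⟨le_normalClosure K, normalClosure_le_iff_of_normal.2 hKM, fun σ x hx => ?_⟩
  have hN : Normal k (normalClosure k K L) := inferInstance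
  exact normal_iff_forall_map_le'.1 hN σ ⟨x, hx, rfl⟩

theorem IntermediateField.finiteDimensional_normalClosure {k L : Type*} [Field k] [Field L]
    [Algebra k L] (K : IntermediateField k L) [FiniteDimensional k K] :
    FiniteDimensional k (normalClosure k K L) := inferInstance

theorem IntermediateField.normalClosure_toRatAlgebra {L : Type*} [Field L] [Algebra ℚ L]
    (K : IntermediateField ℚ L) :
    normalClosure ℚ K L = @normalClosure ℚ K L _ _ _ K.algebra' _ := by
  rw [Subsingleton.elim (DivisionRing.toRatAlgebra : Algebra ℚ K) K.algebra']

/-! ### The field `M = T(δ)` and its Galois-stable subfields -/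

namespace IsInertSqrt

variable {ℓ : ℕ} [Fact ℓ.Prime] {Qbar : Type*} [Field Qbar] [Algebra ℚ Qbar] [IsAlgClosure ℚ Qbar]
  {ι : Qbar →+* AlgebraicClosure ℚ_[ℓ]} {δ : Qbar}

variable (ι) in
/-- The quadratic extension of the maximal totally `ℓ`-adic field generated by `δ`. -/
noncomputable def quadraticField (h : IsInertSqrt ℓ δ) : IntermediateField ℚ Qbar :=
  (maxTotallyLadic ι).sqrtAdjoin δ (h.sq_mem _)

omit [IsAlgClosure ℚ Qbar] in
theorem mem_quadraticField {h : IsInertSqrt ℓ δ} {x : Qbar} :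
    x ∈ h.quadraticField ι ↔
      ∃ f ∈ maxTotallyLadic ι, ∃ g ∈ maxTotallyLadic ι, x = f + g * δ := Iff.rfl

omit [IsAlgClosure ℚ Qbar] in
theorem maxTotallyLadic_le (h : IsInertSqrt ℓ δ) : maxTotallyLadic ι ≤ h.quadraticField ι :=
  IntermediateField.le_sqrtAdjoin _ _ _

omit [IsAlgClosure ℚ Qbar] in
theorem mem_self (h : IsInertSqrt ℓ δ) : δ ∈ h.quadraticField ι :=
  IntermediateField.self_mem_sqrtAdjoin _ _ _

theorem map_mem_quadraticField (h : IsInertSqrt ℓ δ) {x : Qbar} (hx : x ∈ h.quadraticField ι)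
    (σ : Qbar ≃ₐ[ℚ] Qbar) : σ x ∈ h.quadraticField ι := by
  obtain ⟨f, hf, g, hg, rfl⟩ := mem_quadraticField.1 hx
  rw [map_add, map_mul]
  refine add_mem (h.maxTotallyLadic_le (map_mem_maxTotallyLadic hf σ))
    (mul_mem (h.maxTotallyLadic_le (map_mem_maxTotallyLadic hg σ)) ?_)
  rcases h.map_eq_or σ with h1 | h1 <;> rw [h1]
  exacts [h.mem_self, neg_mem h.mem_self]

/-- If `f + g δ` lies in `ℚ_ℓ` with `g ≠ 0`, then so does `δ`, which is impossible. -/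
theorem mem_maxTotallyLadic_of_mem_ladicSubfield (h : IsInertSqrt ℓ δ) {x : Qbar}
    (hx : x ∈ h.quadraticField ι) (hx' : x ∈ ladicSubfield ι) : x ∈ maxTotallyLadic ι := by
  obtain ⟨f, hf, g, hg, rfl⟩ := mem_quadraticField.1 hx
  by_cases hg0 : g = 0
  · subst hg0
    simpa using hf
  · refine absurd ?_ (h.notMem_ladicSubfield (ι := ι))
    have h1 := sub_mem hx' (maxTotallyLadic_le_ladicSubfield hf)
    rw [add_sub_cancel_left] at h1
    exact mul_div_cancel_left₀ δ hg0 ▸ div_mem h1 (maxTotallyLadic_le_ladicSubfield hg)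

theorem le_quadraticField (h : IsInertSqrt ℓ δ) {F K : IntermediateField ℚ Qbar}
    (hFK : F ≤ K) (hF : IsTotallyLadic ι F)
    (hK : IsQuadraticInertAbove ℓ F (IntermediateField.extendScalars hFK)) :
    K ≤ h.quadraticField ι ∧ ¬ K ≤ maxTotallyLadic ι := by
  obtain ⟨y, hy, hy0, hyδ, hall⟩ := h.exists_mul_mem_maxTotallyLadic hFK hF hK
  have hδ : δ ≠ 0 := fun h0 =>
    h.notMem_maxTotallyLadic (ι := ι) (h0 ▸ zero_mem _)
  have hyM : y ∈ h.quadraticField ι :=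
    mul_div_cancel_right₀ y hδ ▸ div_mem (h.maxTotallyLadic_le hyδ) h.mem_self
  refine ⟨fun x hx => ?_, fun hle => ?_⟩
  · obtain ⟨f, hf, g, hg, rfl⟩ := hall x hx
    exact add_mem (h.maxTotallyLadic_le (hF.le_maxTotallyLadic hf))
      (mul_mem (h.maxTotallyLadic_le (hF.le_maxTotallyLadic hg)) hyM)
  · exact h.notMem_maxTotallyLadic (ι := ι)
      (mul_div_cancel_left₀ δ hy0 ▸ div_mem hyδ (hle hy))

theorem eq_quadraticField (h : IsInertSqrt ℓ δ) {E : IntermediateField ℚ Qbar}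
    (hE : maxTotallyLadic ι ≤ E)
    (hK : IsQuadraticInertAbove ℓ (maxTotallyLadic ι) (IntermediateField.extendScalars hE)) :
    E = h.quadraticField ι := by
  have hT := (isGreatest_maxTotallyLadic ι).1
  refine le_antisymm (h.le_quadraticField hE hT hK).1 fun x hx => ?_
  obtain ⟨y, hy, hy0, hyδ, -⟩ := h.exists_mul_mem_maxTotallyLadic hE hT hK
  obtain ⟨f, hf, g, hg, rfl⟩ := mem_quadraticField.1 hx
  exact add_mem (hE hf) (mul_mem (hE hg)
    (mul_div_cancel_left₀ δ hy0 ▸ div_mem (hE hyδ) hy))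

/-- Stability under the conjugation `τ` over `T` puts both components `f` and `g δ` of an element of
`N` in `N`. One element outside `T` supplies the generator `g₀ δ`. -/
theorem isQuadraticInertAbove_inf (h : IsInertSqrt ℓ δ) {N : IntermediateField ℚ Qbar}
    (hN : ∀ σ : Qbar ≃ₐ[ℚ] Qbar, ∀ x ∈ N, σ x ∈ N) (hM : N ≤ h.quadraticField ι)
    (hT : ¬ N ≤ maxTotallyLadic ι) :
    IsQuadraticInertAbove ℓ (N ⊓ maxTotallyLadic ι : IntermediateField ℚ Qbar)
      (IntermediateField.extendScalars (inf_le_left : N ⊓ maxTotallyLadic ι ≤ N)) := by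
  obtain ⟨τ, hτ, hτδ⟩ := h.exists_conj (ι := ι)
  have hparts {f g : Qbar} (hf : f ∈ maxTotallyLadic ι) (hg : g ∈ maxTotallyLadic ι)
      (hx : f + g * δ ∈ N) : f ∈ N ∧ g * δ ∈ N := by
    have h1 := hN τ _ hx
    rw [map_add, map_mul, hτ f hf, hτ g hg, hτδ] at h1
    -- The `T`-component is the mean of the element and its image under `τ`.
    have h2 : f ∈ N := by
      have : CharZero Qbar := algebraRat.charZero Qbar
      have h3 : f = ((f + g * δ) + (f + g * -δ)) / 2 := by ring
      rw [h3]
      exact div_mem (add_mem hx h1) (ofNat_mem N 2)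
    exact ⟨h2, by simpa using sub_mem hx h2⟩
  obtain ⟨x, hx, hxT⟩ := Set.not_subset.1 hT
  obtain ⟨f₀, hf₀, g₀, hg₀, rfl⟩ := mem_quadraticField.1 (hM hx)
  have hg0 : g₀ ≠ 0 := by
    rintro rfl
    exact hxT (by simpa using hf₀)
  obtain ⟨-, hyN⟩ := hparts hf₀ hg₀ hx
  have hδ : δ ≠ 0 := fun h0 => h.notMem_maxTotallyLadic (ι := ι) (h0 ▸ zero_mem _)
  refine h.isQuadraticInertAbove _ inf_le_right hyN (mul_ne_zero hg0 hδ)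
    ⟨pow_mem hyN 2, ?_⟩ ?_ fun z hz => ?_
  · rw [mul_pow]
    exact mul_mem (pow_mem hg₀ 2) (h.sq_mem _)
  · rw [mul_assoc, ← sq]
    exact mul_mem hg₀ (h.sq_mem _)
  · obtain ⟨f, hf, g, hg, rfl⟩ := mem_quadraticField.1 (hM hz)
    obtain ⟨hfN, hgN⟩ := hparts hf hg hz
    -- The coefficient lies in `N` as the quotient of `g δ` by `g₀ δ`.
    refine ⟨f, ⟨hfN, hf⟩, g / g₀, ⟨?_, div_mem hg hg₀⟩, ?_⟩
    · rw [← mul_div_mul_right g g₀ hδ]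
      exact div_mem hgN hyN
    · field_simp

theorem isQuadraticInertAbove_quadraticField (h : IsInertSqrt ℓ δ) :
    IsQuadraticInertAbove ℓ (maxTotallyLadic ι)
      (IntermediateField.extendScalars (h.maxTotallyLadic_le (ι := ι))) := by
  have hδ : δ ≠ 0 := fun h0 => h.notMem_maxTotallyLadic (ι := ι) (h0 ▸ zero_mem _)
  refine h.isQuadraticInertAbove _ le_rfl h.mem_self hδ (h.sq_mem _) ?_
    fun x hx => mem_quadraticField.1 hx
  rw [← sq]
  exact h.sq_mem _

theorem hasUnramifiedQuadraticConj_normalClosure (h : IsInertSqrt ℓ δ)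
    {K : IntermediateField ℚ Qbar} (hK : HasUnramifiedQuadraticConj ι K) :
    HasUnramifiedQuadraticConj ι (IntermediateField.normalClosure ℚ K Qbar) := by
  have : IsGalois ℚ Qbar := isGalois_of_isAlgClosure_rat
  obtain ⟨hfin, F, hFK, hF, hin⟩ := hK
  obtain ⟨hle, hnot⟩ := h.le_quadraticField hFK hF hin
  obtain ⟨hKN, hNM, hN⟩ := IntermediateField.normalClosure_spec
    (fun σ x hx => h.map_mem_quadraticField hx σ) hle
  have hfinN := IntermediateField.finiteDimensional_normalClosure K
  rw [IntermediateField.normalClosure_toRatAlgebra]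
  exact ⟨hfinN, _, inf_le_left, isTotallyLadic_of_le inf_le_right,
    h.isQuadraticInertAbove_inf hN hNM fun hNT => hnot (hKN.trans hNT)⟩

end IsInertSqrt

/-! ### Weil numbers from Cayley transforms -/

section Weil

variable {Qbar : Type*} [Field Qbar] [Algebra ℚ Qbar] [IsAlgClosure ℚ Qbar]

theorem map_mem_rootField {a x : Qbar} (hx : x ∈ rootField a) (σ : Qbar ≃ₐ[ℚ] Qbar) :
    σ x ∈ rootField a := by
  suffices h : rootField a ≤ (rootField a).comap (σ : Qbar →ₐ[ℚ] Qbar) from h hx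
  refine IntermediateField.adjoin_le_iff.2 fun r hr => ?_
  refine IntermediateField.subset_adjoin ℚ _ ?_
  rw [Polynomial.mem_rootSet] at hr ⊢
  refine ⟨hr.1, ?_⟩
  change Polynomial.aeval (σ r) (minpoly ℚ a) = 0
  rw [Polynomial.aeval_algHom_apply, hr.2, map_zero]

theorem rootField_le {a : Qbar} {M : IntermediateField ℚ Qbar}
    (hM : ∀ σ : Qbar ≃ₐ[ℚ] Qbar, σ a ∈ M) : rootField a ≤ M := by
  have : IsGalois ℚ Qbar := isGalois_of_isAlgClosure_rat
  refine IntermediateField.adjoin_le_iff.2 fun r hr => ?_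
  obtain ⟨σ, hσ⟩ := minpoly.exists_algEquiv_of_root' (Algebra.IsAlgebraic.isAlgebraic a)
    (Polynomial.mem_rootSet.1 hr).2
  exact hσ ▸ hM σ

theorem IntermediateField.norm_eq_of_algEquiv_fixing {k L : Type*} [Field k] [Field L]
    [Algebra k L] {H N : IntermediateField k L} (hHN : H ≤ N) (τ : L ≃ₐ[k] L)
    (hτ : ∀ x ∈ N, τ x ∈ N) (hτ' : ∀ x ∈ N, τ.symm x ∈ N) (hH : ∀ x ∈ H, τ x = x)
    {x y : IntermediateField.extendScalars hHN} (hxy : τ x = y) :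
    Algebra.norm H x = Algebra.norm H y := by
  let e : IntermediateField.extendScalars hHN ≃ₐ[H] IntermediateField.extendScalars hHN :=
    { toFun := fun z => ⟨τ z, hτ z z.2⟩
      invFun := fun z => ⟨τ.symm z, hτ' z z.2⟩
      left_inv := fun z => Subtype.ext (τ.symm_apply_apply _)
      right_inv := fun z => Subtype.ext (τ.apply_symm_apply _)
      map_mul' := fun z w => Subtype.ext (map_mul τ _ _)
      map_add' := fun z w => Subtype.ext (map_add τ _ _)
      commutes' := fun c => Subtype.ext (hH c c.2) }
  have h1 : e x = y := Subtype.ext hxy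
  rw [← h1, Algebra.norm_eq_of_algEquiv]

variable {ℓ : ℕ} [Fact ℓ.Prime] {ι : Qbar →+* AlgebraicClosure ℚ_[ℓ]} {δ : Qbar}

/-- Let `b = δ / u` and let `a` be its Cayley transform. The conjugation over `T` sends each `σ b`
to `-σ b`, so `1 - σ b` and `1 + σ b` have equal norms and their quotient `σ a` has norm 1. Moreover
`ℚ(a) = ℚ(b)` is quadratic over the totally ℓ-adic field `ℚ(b ^ 2)`. -/
theorem IsInertSqrt.isQuadraticWeilNumber (h : IsInertSqrt ℓ δ) {u : Qbar} (hu0 : u ≠ 0)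
    (hu : u ∈ maxTotallyLadic ι) :
    IsQuadraticWeilNumber ι ((1 + δ / u) / (1 - δ / u)) := by
  have hchar : CharZero Qbar := algebraRat.charZero Qbar
  have hδ : δ ≠ 0 := fun h0 => h.notMem_maxTotallyLadic (ι := ι) (h0 ▸ zero_mem _)
  set b := δ / u with hb
  have hbT : b ∉ maxTotallyLadic ι := fun hmem =>
    h.notMem_maxTotallyLadic (ι := ι) (div_mul_cancel₀ δ hu0 ▸ mul_mem hmem hu)
  have hb1 : 1 - b ≠ 0 := fun h0 => hbT ((sub_eq_zero.1 h0) ▸ one_mem _)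
  have hb2 : 1 + b ≠ 0 := fun h0 => hbT ((eq_neg_of_add_eq_zero_right h0) ▸ neg_mem (one_mem _))
  have hbM : b ∈ h.quadraticField ι := div_mem h.mem_self (h.maxTotallyLadic_le hu)
  set a := (1 + b) / (1 - b) with ha
  have ha1 : a + 1 = 2 / (1 - b) := by
    rw [ha]
    field_simp
    ring
  have ha10 : a + 1 ≠ 0 := by
    rw [ha1]
    exact div_ne_zero two_ne_zero hb1
  have hba : b = (a - 1) / (a + 1) := by
    rw [eq_div_iff ha10, ha]
    field_simp
    ring
  have haM : a ∈ h.quadraticField ι := div_mem (add_mem (one_mem _) hbM) (sub_mem (one_mem _) hbM)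
  refine ⟨⟨div_ne_zero hb2 hb1, fun σ => ⟨1, one_pos, ?_⟩⟩, ?_⟩
  · rw [pow_one]
    obtain ⟨τ, hτ, hτδ⟩ := h.exists_conj (ι := ι)
    have hτb : τ (σ b) = -σ b := by
      rw [hb, map_div₀, map_div₀, hτ _ (map_mem_maxTotallyLadic hu σ)]
      rcases h.map_eq_or σ with h1 | h1 <;> rw [h1]
      · rw [hτδ, neg_div]
      · rw [map_neg, hτδ, neg_div]
    have hσa := conj_mem_rootField a σ
    have hbN : σ b ∈ rootField a := by
      rw [hba, map_div₀, map_sub, map_add, map_one]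
      exact div_mem (sub_mem hσa (one_mem _)) (add_mem hσa (one_mem _))
    have hNM : rootField a ≤ h.quadraticField ι :=
      rootField_le fun ρ => h.map_mem_quadraticField haM ρ
    let B : IntermediateField.extendScalars
      (inf_le_left : rootField a ⊓ ladicSubfield ι ≤ rootField a) := ⟨σ b, hbN⟩
    have hB : 1 - B ≠ 0 := fun h0 => hb1 <| by
      have h1 : 1 - σ b = 0 := congrArg Subtype.val h0
      rwa [← map_one σ, ← map_sub, map_eq_zero] at h1
    have hnorm : Algebra.norm ↥(rootField a ⊓ ladicSubfield ι) (1 - B)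
        = Algebra.norm ↥(rootField a ⊓ ladicSubfield ι) (1 + B) := by
      refine IntermediateField.norm_eq_of_algEquiv_fixing
        (inf_le_left : rootField a ⊓ ladicSubfield ι ≤ rootField a) τ (fun x hx => map_mem_rootField hx τ)
        (fun x hx => map_mem_rootField hx τ.symm)
        -- The base field `rootField a ⊓ ladicSubfield ι` lies in `M ∩ ℚ_ℓ`, hence in `T`, which `τ`
        -- fixes.
        (fun x hx => hτ x (h.mem_maxTotallyLadic_of_mem_ladicSubfield (hNM hx.1) hx.2)) ?_
      change τ (1 - σ b) = 1 + σ b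
      rw [map_sub, map_one, hτb, sub_neg_eq_add]
    have hmul : localNorm ι a σ * Algebra.norm ↥(rootField a ⊓ ladicSubfield ι) (1 - B)
        = Algebra.norm ↥(rootField a ⊓ ladicSubfield ι) (1 - B) := by
      conv_rhs => rw [hnorm]
      rw [localNorm, ← map_mul]
      congr 1
      apply Subtype.ext
      change σ a * (1 - σ b) = 1 + σ b
      rw [← map_one σ, ← map_sub, ← map_add, ← map_mul, ha, div_mul_cancel₀ _ hb1]
    have hne : Algebra.norm ↥(rootField a ⊓ ladicSubfield ι) (1 - B) ≠ 0 :=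
      ((isUnit_iff_ne_zero.2 hB).map
        (Algebra.norm ↥(rootField a ⊓ ladicSubfield ι))).ne_zero
    exact mul_right_cancel₀ hne (hmul.trans (one_mul _).symm)
  · have : Algebra.IsAlgebraic ℚ Qbar := IsAlgClosure.isAlgebraic
    have hbK : b ∈ ℚ⟮a⟯ := by
      have := IntermediateField.mem_adjoin_simple_self ℚ a
      rw [hba]
      exact div_mem (sub_mem this (one_mem _)) (add_mem this (one_mem _))
    have hb2K : ℚ⟮b ^ 2⟯ ≤ ℚ⟮a⟯ := IntermediateField.adjoin_simple_le_iff.2 (pow_mem hbK 2)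
    have hb2T : ℚ⟮b ^ 2⟯ ≤ maxTotallyLadic ι := by
      rw [IntermediateField.adjoin_simple_le_iff, hb, div_pow]
      exact div_mem (h.sq_mem _) (pow_mem hu 2)
    have hb2 := IntermediateField.mem_adjoin_simple_self ℚ (b ^ 2)
    refine ⟨IntermediateField.adjoin.finiteDimensional (Algebra.IsIntegral.isIntegral a),
      ℚ⟮b ^ 2⟯, hb2K, isTotallyLadic_of_le hb2T,
      h.isQuadraticInertAbove hb2K hb2T hbK (div_ne_zero hδ hu0) hb2 ?_ fun x hx => ?_⟩
    · rw [hb, div_mul_eq_mul_div, ← sq]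
      exact div_mem (h.sq_mem _) hu
    · have hle : ℚ⟮a⟯ ≤ ℚ⟮b ^ 2⟯.sqrtAdjoin b hb2 := by
        rw [IntermediateField.adjoin_simple_le_iff]
        have := ℚ⟮b ^ 2⟯.self_mem_sqrtAdjoin b hb2
        exact div_mem (add_mem (one_mem _) this) (sub_mem (one_mem _) this)
      exact IntermediateField.mem_sqrtAdjoin.1 (hle hx)

theorem IsInertSqrt.quadraticWeilField_eq (h : IsInertSqrt ℓ δ) :
    quadraticWeilField ι = h.quadraticField ι := by
  apply le_antisymm
  · refine IntermediateField.adjoin_le_iff.2 fun a ha => ?_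
    obtain ⟨-, F, hFK, hF, hin⟩ := ha.2
    exact (h.le_quadraticField hFK hF hin).1 (IntermediateField.mem_adjoin_simple_self ℚ a)
  · have hchar : CharZero Qbar := algebraRat.charZero Qbar
    have hδ0 : δ ≠ 0 := fun h0 => h.notMem_maxTotallyLadic (ι := ι) (h0 ▸ zero_mem _)
    have hmem {u : Qbar} (hu0 : u ≠ 0) (hu : u ∈ maxTotallyLadic ι) :
        δ / u ∈ quadraticWeilField ι := by
      have h1 : (1 + δ / u) / (1 - δ / u) ∈ quadraticWeilField ι :=
        IntermediateField.subset_adjoin ℚ _ (h.isQuadraticWeilNumber hu0 hu)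
      have hb1 : 1 - δ / u ≠ 0 := fun h0 => h.notMem_maxTotallyLadic (ι := ι) <| by
        have : δ = u := ((div_eq_one_iff_eq hu0).1 (sub_eq_zero.1 h0).symm)
        exact this ▸ hu
      set a := (1 + δ / u) / (1 - δ / u) with ha
      have ha1 : a + 1 = 2 / (1 - δ / u) := by
        rw [ha, div_add_one hb1]
        congr 1
        ring
      have ha10 : a + 1 ≠ 0 := by
        rw [ha1]
        exact div_ne_zero two_ne_zero hb1
      have hba : δ / u = (a - 1) / (a + 1) := by
        rw [eq_div_iff ha10, ha1, ha, div_sub_one hb1]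
        field_simp
        ring
      rw [hba]
      exact div_mem (sub_mem h1 (one_mem _)) (add_mem h1 (one_mem _))
    have hδ : δ ∈ quadraticWeilField ι := by simpa using hmem one_ne_zero (one_mem _)
    have hT : maxTotallyLadic ι ≤ quadraticWeilField ι := by
      intro u hu
      by_cases hu0 : u = 0
      · exact hu0 ▸ zero_mem _
      -- Both `δ` (the case `u = 1`) and `δ / u` are already in the field, hence so is their
      -- quotient.
      · have h1 : u = δ / (δ / u) := by field_simp
        rw [h1]
        exact div_mem hδ (hmem hu0 hu)
    intro x hx
    obtain ⟨f, hf, g, hg, rfl⟩ := IsInertSqrt.mem_quadraticField.1 hx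
    exact add_mem (hT hf) (mul_mem (hT hg) hδ)

end Weil

theorem mainTheorem9 (ℓ : ℕ) [Fact ℓ.Prime]
    {Qbar : Type*} [Field Qbar] [Algebra ℚ Qbar] [IsAlgClosure ℚ Qbar]
    (ι : Qbar →+* AlgebraicClosure ℚ_[ℓ]) :
    (∀ a : Qbar, IsQuadraticWeilNumber ι a →
      HasUnramifiedQuadraticConj ι
        (IntermediateField.normalClosure ℚ ℚ⟮a⟯ Qbar)) ∧
    (∃ h : maxTotallyLadic ι ≤ quadraticWeilField ι,
      IsQuadraticInertAbove ℓ (maxTotallyLadic ι) (IntermediateField.extendScalars h)) ∧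
    (∀ (E : IntermediateField ℚ Qbar) (h : maxTotallyLadic ι ≤ E),
      IsQuadraticInertAbove ℓ (maxTotallyLadic ι) (IntermediateField.extendScalars h) →
        E = quadraticWeilField ι) := by
  have : IsAlgClosed Qbar := IsAlgClosure.isAlgClosed ℚ
  obtain ⟨δ, h⟩ := exists_isInertSqrt ℓ Qbar
  rw [h.quadraticWeilField_eq (ι := ι)]
  exact ⟨fun a ha => h.hasUnramifiedQuadraticConj_normalClosure ha.2,
    ⟨h.maxTotallyLadic_le, h.isQuadraticInertAbove_quadraticField⟩,
    fun E hE hin => h.eq_quadraticField hE hin⟩
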